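/- Let $c_1,\dots,c_r\in(0,1)$ be finitely many distinct points and let $f:[0,1]\to\mathbb R$ be twice differentiable on $[0,1]\setminus\{c_1,\dots,c_r\}$ (one-sidedly at $0$ and $1$) with bounded second derivative there. Suppose that at each $c_j$ both one-sided limits $f(c_j-)$ and $f(c_j+)$ exist and are finite, and that $f>2+\epsilon$ on $[0,1]$ for some $\epsilon>0$. Let $T_n(f)$ be the $n\times n$ tridiagonal matrix with diagonal entries $f(1/n),f(2/n),\dots,f(n/n)$ and all entries directly above and below the diagonal equal to $-1$; put $D_n(f)=\det T_n(f)$ and $$G(f)=\exp\left\{\int_0^1\log\left(\frac{f(x)+\sqrt{f(x)^2-4}}{2}\right)dx\right\}.$$ Define $$\alpha=\frac12\,\frac{f(1)+\sqrt{f(1)^2-4}}{\sqrt[4]{(f(0)^2-4)(f(1)^2-4)}},\qquad \beta_j=\frac{f(c_j-)-f(c_j+)+\sqrt{f(c_j+)^2-4}+\sqrt{f(c_j-)^2-4}}{2\sqrt[4]{(f(c_j+)^2-4)(f(c_j-)^2-4)}},$$ $$\gamma_j=\frac{f(c_j+)+\sqrt{f(c_j+)^2-4}}{f(c_j-)+\sqrt{f(c_j-)^2-4}},$$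 and let $\{x\}=x-\lfloor x\rfloor$ and $\{x\}'=1+x-\lceil x\rceil$. (i) If $f$ is left-continuous at every $c_j$, i.e. $f(c_j)=f(c_j-)$, then, as $n\to\infty$, $$\frac{D_n(f)}{G(f)^n}=\alpha\prod_{j=1}^r\beta_j\gamma_j^{\{nc_j\}}+o(1).$$ (ii) More generally, if $f$ is left-continuous or right-continuous at each $c_j$, then the same formula holds with $\{nc_j\}$ replaced by $\{nc_j\}'$ for those $j$ at which $f$ is taken to be right-continuous, i.e. $f(c_j)=f(c_j+)$ (in particular, for all $j$ if $f$ is right-continuous at every $c_j$). -/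

import Mathlib

open Filter Topology

noncomputable section

namespace DiscreteSchrodinger

/-- The `n × n` discrete Schrödinger matrix: diagonal entries `f(1/n), f(2/n), …, f(n/n)`,
entries `-1` directly above and below the diagonal, and `0` elsewhere.
The index `i : Fin n` runs over `0, …, n - 1`. -/
def T (n : ℕ) (f : ℝ → ℝ) : Matrix (Fin n) (Fin n) ℝ :=
  Matrix.of fun i j =>
    if i = j then f (((i : ℕ) + 1 : ℝ) / (n : ℝ))
    else if (i : ℕ) + 1 = (j : ℕ) ∨ (j : ℕ) + 1 = (i : ℕ) then -1
    else 0

/-- `D_n(f) = det T_n(f)`. -/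
def D (n : ℕ) (f : ℝ → ℝ) : ℝ := (T n f).det

/-- `G(f) = exp ∫₀¹ log ((f(x) + √(f(x)² - 4)) / 2) dx`. -/
def G (f : ℝ → ℝ) : ℝ :=
  Real.exp (∫ x in (0 : ℝ)..1, Real.log ((f x + Real.sqrt (f x ^ 2 - 4)) / 2))

/-- `f` is twice differentiable at every point of `S`, relative to `S`, with a second derivative
that is bounded on `S`. (Here `f₁` is the first and `f₂` the second derivative. For
`S = [0,1] \ {finitely many interior points}` these are ordinary derivatives at the interior
points of `S` and one-sided derivatives at `0` and `1`.) -/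
def TwiceDiffBddOn (f : ℝ → ℝ) (S : Set ℝ) : Prop :=
  ∃ f₁ f₂ : ℝ → ℝ, ∃ M : ℝ, ∀ x ∈ S,
    HasDerivWithinAt f (f₁ x) S x ∧ HasDerivWithinAt f₁ (f₂ x) S x ∧ |f₂ x| ≤ M

/-- The constant `α`, as a function of `a = f(0)` and `b = f(1)`. -/
def alpha (a b : ℝ) : ℝ :=
  (1 / 2) * ((b + Real.sqrt (b ^ 2 - 4)) / ((a ^ 2 - 4) * (b ^ 2 - 4)) ^ (1 / 4 : ℝ))

/-- The constant `β`, as a function of the one-sided limits `l = f(c-)` and `u = f(c+)`. -/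
def beta (l u : ℝ) : ℝ :=
  (l - u + Real.sqrt (u ^ 2 - 4) + Real.sqrt (l ^ 2 - 4)) /
    (2 * ((u ^ 2 - 4) * (l ^ 2 - 4)) ^ (1 / 4 : ℝ))

/-- The constant `γ`, as a function of the one-sided limits `l = f(c-)` and `u = f(c+)`. -/
def gamma (l u : ℝ) : ℝ :=
  (u + Real.sqrt (u ^ 2 - 4)) / (l + Real.sqrt (l ^ 2 - 4))

/-- `{x}' = 1 + x - ⌈x⌉`: the fractional part of `x`, but equal to `1` if `x` is an integer. -/
def fract' (x : ℝ) : ℝ := 1 + x - (⌈x⌉ : ℝ)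

end DiscreteSchrodinger

end

/-!
Write `f = 2 * cosh a`. The ratio of the determinants of consecutive leading blocks of the matrix
obeys a contracting recursion whose fixed point, if `a` were constant, would be `exp (-a)`; so it
tracks `exp (-a (k / n))`, up to `O(1 / n)` between the jumps of `f`. The determinant factors
exactly into a factor depending on both endpoints, one factor `exp (a y) * β` for each pair `x`, `y`
of adjacent grid points, where `β` is formed from `a x` and `a y` as in the theorem, and an error
which is a product of `1 + O(deviation * variation)` and therefore tends to `1`.

Since `log β = (a x - a y) / 2 + O((a x - a y) ^ 2)`, the factor of a cell without jump is the
exponential of the trapezoidal approximation to `n ∫ a`, and the product of the quotients by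
`exp (n ∫ a)` tends to `1`. A cell with a jump at the fraction `θ` of its length, from `l` to `u`,
contributes `β * exp (u - (θ * l + (1 - θ) * u)) = β * exp (θ * (u - l)) = β * γ ^ θ`.
-/

noncomputable section

namespace DiscreteSchrodinger

open MeasureTheory

section Tridiagonal

variable {R : Type*} [CommRing R]

theorem det_eq_mul_det_of_last_column_eq_zero {n : ℕ} (A : Matrix (Fin (n + 1)) (Fin (n + 1)) R)
    (hA : ∀ i : Fin n, A i.castSucc (Fin.last n) = 0) :
    A.det = A (Fin.last n) (Fin.last n) * (A.submatrix Fin.castSucc Fin.castSucc).det := by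
  rw [A.det_succ_column (Fin.last n), Fin.sum_univ_castSucc,
    Finset.sum_eq_zero fun i _ => by simp [hA i], Fin.succAbove_last]
  simp [← two_mul]

/-- The tridiagonal matrix with diagonal entries `d 1, …, d n` and off-diagonal entries `-1`. -/
def tridiag (d : ℕ → R) (n : ℕ) : Matrix (Fin n) (Fin n) R :=
  Matrix.of fun i j =>
    if i = j then d ((i : ℕ) + 1)
    else if (i : ℕ) + 1 = (j : ℕ) ∨ (j : ℕ) + 1 = (i : ℕ) then -1
    else 0

theorem tridiag_apply_self (d : ℕ → R) {n : ℕ} (i : Fin n) : tridiag d n i i = d (i + 1) := by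
  simp [tridiag]

theorem tridiag_apply_of_add_one_eq (d : ℕ → R) {n : ℕ} {i j : Fin n}
    (h : (i : ℕ) + 1 = j ∨ (j : ℕ) + 1 = i) : tridiag d n i j = -1 := by
  have hij : i ≠ j := by rintro rfl; omega
  simp [tridiag, hij, h]

theorem tridiag_apply_of_add_one_lt (d : ℕ → R) {n : ℕ} {i j : Fin n}
    (h : (i : ℕ) + 1 < j ∨ (j : ℕ) + 1 < i) : tridiag d n i j = 0 := by
  have hij : i ≠ j := by rintro rfl; omega
  simp only [tridiag, Matrix.of_apply, if_neg hij]
  exact if_neg (by omega)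

theorem tridiag_submatrix_castSucc (d : ℕ → R) (n : ℕ) :
    (tridiag d (n + 1)).submatrix Fin.castSucc Fin.castSucc = tridiag d n := by
  ext i j
  simp [tridiag, Fin.ext_iff]

theorem det_tridiag_zero (d : ℕ → R) : (tridiag d 0).det = 1 :=
  Matrix.det_fin_zero

theorem det_tridiag_one (d : ℕ → R) : (tridiag d 1).det = d 1 := by
  simp [tridiag]

theorem det_tridiag_submatrix_castSucc_succAbove (d : ℕ → R) (n : ℕ) :
    ((tridiag d (n + 2)).submatrix Fin.castSucc (Fin.last n).castSucc.succAbove).det =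
      -(tridiag d n).det := by
  have hlast : (Fin.last n).castSucc.succAbove (Fin.last n) = Fin.last (n + 1) := by
    rw [Fin.succAbove_of_le_castSucc _ _ le_rfl, Fin.succ_last]
  have hcast (j : Fin n) : (Fin.last n).castSucc.succAbove j.castSucc = j.castSucc.castSucc :=
    Fin.succAbove_of_castSucc_lt _ _ (by simp [Fin.lt_def])
  rw [det_eq_mul_det_of_last_column_eq_zero]
  · rw [Matrix.submatrix_submatrix, Matrix.submatrix_apply, hlast,
      tridiag_apply_of_add_one_eq _ (by simp), neg_one_mul]
    congr 2
    ext i j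
    simp [tridiag, hcast, Fin.ext_iff]
  · intro i
    rw [Matrix.submatrix_apply, hlast]
    exact tridiag_apply_of_add_one_lt d (by simp)

theorem det_tridiag_add_two (d : ℕ → R) (n : ℕ) :
    (tridiag d (n + 2)).det = d (n + 2) * (tridiag d (n + 1)).det - (tridiag d n).det := by
  have hzero (i : Fin n) : tridiag d (n + 2) (Fin.last (n + 1)) i.castSucc.castSucc = 0 :=
    tridiag_apply_of_add_one_lt d (by simp)
  rw [Matrix.det_succ_row _ (Fin.last (n + 1)), Fin.sum_univ_castSucc, Fin.sum_univ_castSucc,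
    Finset.sum_eq_zero fun i _ => by simp [hzero i], Fin.succAbove_last,
    det_tridiag_submatrix_castSucc_succAbove, tridiag_submatrix_castSucc, tridiag_apply_self,
    tridiag_apply_of_add_one_eq _ (by simp)]
  have hsign : (-1 : R) ^ (n + 1 + n) = -1 := Odd.neg_one_pow ⟨n, by ring⟩
  have hsign' : (-1 : R) ^ (n + 1 + (n + 1)) = 1 := Even.neg_one_pow ⟨n + 1, rfl⟩
  simp only [Fin.val_last, Fin.val_castSucc, hsign, hsign']
  ring

end Tridiagonal

section Contraction

variable {x v : ℕ → ℝ} {ρ : ℝ}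

theorem le_pow_mul_add_div_of_contraction (hρ : 0 ≤ ρ) (hρ' : ρ < 1)
    (hx : ∀ k, x (k + 1) ≤ ρ * (x k + v k)) {δ : ℝ} (hδ : 0 ≤ δ) (k N : ℕ)
    (hv : ∀ i, k ≤ i → i < k + N → v i ≤ δ) : x (k + N) ≤ ρ ^ N * x k + δ / (1 - ρ) := by
  have h1ρ : 0 < 1 - ρ := sub_pos.2 hρ'
  induction N with
  | zero => simpa using div_nonneg hδ h1ρ.le
  | succ N ih =>
    have hfix : ρ * (δ / (1 - ρ) + δ) ≤ δ / (1 - ρ) := by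
      rw [div_add' _ _ _ h1ρ.ne', ← mul_div_assoc]
      gcongr
      nlinarith [mul_nonneg hδ (sq_nonneg (1 - ρ))]
    calc x (k + N + 1) ≤ ρ * (x (k + N) + v (k + N)) := hx _
      _ ≤ ρ * (ρ ^ N * x k + δ / (1 - ρ) + δ) := by
          gcongr
          · exact ih fun i hi hi' => hv i hi (by omega)
          · exact hv _ (by omega) (by omega)
      _ = ρ ^ (N + 1) * x k + ρ * (δ / (1 - ρ) + δ) := by ring
      _ ≤ _ := by gcongr

theorem sum_le_of_contraction (hρ' : ρ ≤ 1) (hx : ∀ k, x (k + 1) ≤ ρ * (x k + v k))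
    (hv : ∀ k, 0 ≤ v k) (n : ℕ) :
    (1 - ρ) * ∑ k ∈ Finset.range n, x k + x n ≤ x 0 + ∑ k ∈ Finset.range n, v k := by
  induction n with
  | zero => simp
  | succ n ih =>
    rw [Finset.sum_range_succ, Finset.sum_range_succ]
    nlinarith [hx n, mul_le_of_le_one_left (hv n) hρ']

end Contraction

section DetRatio

variable {a : ℕ → ℝ}

/-- The ratio `D_{k-1} / D_k` of consecutive determinants of the tridiagonal matrices with diagonal
`2 cosh (a 1), 2 cosh (a 2), …`, given by its recursion, with the convention `D_{-1} = 0`. -/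
def detRatio (a : ℕ → ℝ) : ℕ → ℝ
  | 0 => 0
  | k + 1 => (2 * Real.cosh (a (k + 1)) - detRatio a k)⁻¹

theorem detRatio_mem_Icc (a : ℕ → ℝ) (k : ℕ) : detRatio a k ∈ Set.Icc (0 : ℝ) 1 := by
  induction k with
  | zero => simp [detRatio]
  | succ k ih =>
    have hone : 1 ≤ 2 * Real.cosh (a (k + 1)) - detRatio a k := by
      linarith [Real.one_le_cosh (a (k + 1)), ih.2]
    exact ⟨inv_nonneg.2 (zero_le_one.trans hone), inv_le_one_of_one_le₀ hone⟩

theorem detRatio_succ_mul (a : ℕ → ℝ) (k : ℕ) :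
    detRatio a (k + 1) * (2 * Real.cosh (a (k + 1)) - detRatio a k) = 1 := by
  have hone := Real.one_le_cosh (a (k + 1))
  exact inv_mul_cancel₀ (by linarith [(detRatio_mem_Icc a k).2])

theorem det_tridiag_succ_mul_detRatio (a : ℕ → ℝ) (k : ℕ) :
    (tridiag (fun i => 2 * Real.cosh (a i)) (k + 1)).det * detRatio a (k + 1) =
      (tridiag (fun i => 2 * Real.cosh (a i)) k).det := by
  induction k with
  | zero =>
    have hrec := detRatio_succ_mul a 0
    rw [detRatio, sub_zero, mul_comm] at hrec
    rw [det_tridiag_one, det_tridiag_zero, hrec]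
  | succ k ih =>
    rw [det_tridiag_add_two, ← ih]
    linear_combination
      (tridiag (fun i => 2 * Real.cosh (a i)) (k + 1)).det * detRatio_succ_mul a (k + 1)

theorem detRatio_succ_sub_exp_neg (a : ℕ → ℝ) (k : ℕ) :
    detRatio a (k + 1) - Real.exp (-a (k + 1)) =
      detRatio a (k + 1) * Real.exp (-a (k + 1)) * (detRatio a k - Real.exp (-a (k + 1))) := by
  have hexp : Real.exp (a (k + 1)) * Real.exp (-a (k + 1)) = 1 := by simp [← Real.exp_add]
  have hrec := detRatio_succ_mul a k
  rw [Real.cosh_eq] at hrec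
  linear_combination Real.exp (-a (k + 1)) * hrec - detRatio a (k + 1) * hexp

theorem det_tridiag_succ_mul_one_sub (a : ℕ → ℝ) (k : ℕ) :
    (tridiag (fun i => 2 * Real.cosh (a i)) (k + 1)).det *
        (1 - detRatio a (k + 1) * Real.exp (-a (k + 1))) =
      (tridiag (fun i => 2 * Real.cosh (a i)) k).det *
        (Real.exp (a (k + 1)) * (1 - detRatio a k * Real.exp (-a (k + 1)))) := by
  have hexp : Real.exp (a (k + 1)) * Real.exp (-a (k + 1)) = 1 := by simp [← Real.exp_add]
  have hrec := detRatio_succ_mul a k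
  rw [Real.cosh_eq] at hrec
  linear_combination
    Real.exp (a (k + 1)) * (1 - detRatio a k * Real.exp (-a (k + 1))) *
        det_tridiag_succ_mul_detRatio a k +
      (tridiag (fun i => 2 * Real.cosh (a i)) (k + 1)).det *
        (detRatio a (k + 1) * detRatio a k * hexp - hrec)

theorem exp_neg_lt_one {x : ℝ} (hx : 0 < x) : Real.exp (-x) < 1 :=
  Real.exp_lt_one_iff.2 (neg_lt_zero.2 hx)

theorem one_sub_detRatio_mul_exp_neg_pos (a : ℕ → ℝ) (k : ℕ) {x : ℝ} (hx : 0 < x) :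
    0 < 1 - detRatio a k * Real.exp (-x) :=
  sub_pos.2 <| (mul_le_of_le_one_left (Real.exp_pos _).le (detRatio_mem_Icc a k).2).trans_lt
    (exp_neg_lt_one hx)

/-- The factor by which the normalized amplitude
`D_k (1 - detRatio a k * exp (-a k)) / (√(sinh (a k)) exp (a 1 + ⋯ + a k))` is multiplied when the
parameter `a` jumps from `x` to `y`, up to the relative error `defect`. It is the constant `β` in
the coordinates `f(c-) = 2 cosh x` and `f(c+) = 2 cosh y`. -/
def transmission (x y : ℝ) : ℝ :=
  (Real.exp x - Real.exp (-y)) / (2 * √(Real.sinh x * Real.sinh y))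

theorem transmission_pos {x y : ℝ} (hx : 0 < x) (hy : 0 < y) : 0 < transmission x y := by
  have hexp : Real.exp (-y) < Real.exp x := Real.exp_lt_exp.2 (by linarith)
  exact div_pos (sub_pos.2 hexp) <| mul_pos two_pos <| Real.sqrt_pos.2 <|
    mul_pos (Real.sinh_pos_iff.2 hx) (Real.sinh_pos_iff.2 hy)

theorem transmission_mul_sqrt_sinh_div {x y : ℝ} (hx : 0 < x) (hy : 0 < y) :
    transmission x y * √(Real.sinh y / Real.sinh x) =
      (1 - Real.exp (-x) * Real.exp (-y)) / (1 - Real.exp (-x) ^ 2) := by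
  have hsx := Real.sinh_pos_iff.2 hx
  have hsy := Real.sinh_pos_iff.2 hy
  have hexp : Real.exp x * Real.exp (-x) = 1 := by simp [← Real.exp_add]
  have hden : 1 - Real.exp (-x) ^ 2 ≠ 0 := by
    nlinarith [exp_neg_lt_one hx, Real.exp_pos (-x)]
  calc transmission x y * √(Real.sinh y / Real.sinh x)
      = (Real.exp x - Real.exp (-y)) / (2 * √(Real.sinh x) ^ 2) := by
        have := Real.sqrt_pos.2 hsx
        have := Real.sqrt_pos.2 hsy
        rw [transmission, Real.sqrt_mul hsx.le, Real.sqrt_div hsy.le]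
        field_simp
    _ = (Real.exp x - Real.exp (-y)) / (Real.exp x - Real.exp (-x)) := by
        rw [Real.sq_sqrt hsx.le, Real.sinh_eq]; ring
    _ = _ := by
        rw [div_eq_div_iff (by have := Real.sinh_eq x; linarith) hden]
        linear_combination (Real.exp (-y) - Real.exp (-x)) * hexp

/-- The relative error made in step `k` by replacing the ratio of determinants by `exp (-a k)`. -/
def defect (a : ℕ → ℝ) (k : ℕ) : ℝ :=
  (Real.exp (-a k) - detRatio a k) * (Real.exp (-a (k + 1)) - Real.exp (-a k)) /
    ((1 - detRatio a k * Real.exp (-a k)) * (1 - Real.exp (-a k) * Real.exp (-a (k + 1))))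

theorem one_sub_exp_neg_mul_exp_neg_pos {x y : ℝ} (hx : 0 < x) (hy : 0 < y) :
    0 < 1 - Real.exp (-x) * Real.exp (-y) :=
  sub_pos.2 (mul_lt_one_of_nonneg_of_lt_one_left (Real.exp_pos _).le (exp_neg_lt_one hx)
    (exp_neg_lt_one hy).le)

theorem one_sub_detRatio_mul_div (ha : ∀ k, 0 < a k) (k : ℕ) :
    (1 - detRatio a k * Real.exp (-a (k + 1))) / (1 - detRatio a k * Real.exp (-a k)) =
      transmission (a k) (a (k + 1)) * √(Real.sinh (a (k + 1)) / Real.sinh (a k)) *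
        (1 + defect a k) := by
  have h₁ := (one_sub_detRatio_mul_exp_neg_pos a k (ha k)).ne'
  have h₂ := (one_sub_exp_neg_mul_exp_neg_pos (ha k) (ha (k + 1))).ne'
  have h₃ := (one_sub_exp_neg_mul_exp_neg_pos (ha k) (ha k)).ne'
  rw [transmission_mul_sqrt_sinh_div (ha k) (ha (k + 1)), defect, sq,
    one_add_div (mul_ne_zero h₁ h₂), div_mul_div_comm,
    div_eq_div_iff h₁ (mul_ne_zero h₃ (mul_ne_zero h₁ h₂))]
  ring

theorem prod_sqrt_sinh_div (ha : ∀ k, 0 < a k) (n : ℕ) :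
    ∏ k ∈ Finset.range n, √(Real.sinh (a (k + 1)) / Real.sinh (a k)) =
      √(Real.sinh (a n) / Real.sinh (a 0)) := by
  have hs (k : ℕ) : 0 < Real.sinh (a k) := Real.sinh_pos_iff.2 (ha k)
  induction n with
  | zero => simp [(hs 0).ne']
  | succ n ih =>
    rw [Finset.prod_range_succ, ih, ← Real.sqrt_mul (div_pos (hs n) (hs 0)).le, mul_comm,
      div_mul_div_cancel₀ (hs n).ne']

theorem det_tridiag_mul_one_sub (ha : ∀ k, 0 < a k) (n : ℕ) :
    (tridiag (fun i => 2 * Real.cosh (a i)) n).det * (1 - detRatio a n * Real.exp (-a n)) =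
      √(Real.sinh (a n) / Real.sinh (a 0)) *
        (∏ k ∈ Finset.range n, Real.exp (a (k + 1)) * transmission (a k) (a (k + 1))) *
          ∏ k ∈ Finset.range n, (1 + defect a k) := by
  have hprod : (tridiag (fun i => 2 * Real.cosh (a i)) n).det *
      (1 - detRatio a n * Real.exp (-a n)) =
        ∏ k ∈ Finset.range n, Real.exp (a (k + 1)) *
          ((1 - detRatio a k * Real.exp (-a (k + 1))) /
            (1 - detRatio a k * Real.exp (-a k))) := by
    induction n with
    | zero => simp [detRatio]
    | succ n ih =>
      have hpos := one_sub_detRatio_mul_exp_neg_pos a n (ha n)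
      rw [Finset.prod_range_succ, ← ih, det_tridiag_succ_mul_one_sub]
      field_simp
  rw [hprod, ← prod_sqrt_sinh_div ha, ← Finset.prod_mul_distrib, ← Finset.prod_mul_distrib]
  exact Finset.prod_congr rfl fun k _ => by rw [one_sub_detRatio_mul_div ha]; ring

end DetRatio

section Deviation

variable {a : ℕ → ℝ} {σ : ℝ}

/-- The distance of the ratio of consecutive determinants from the value it would have if `a` were
constant. -/
def deviation (a : ℕ → ℝ) (k : ℕ) : ℝ := |detRatio a k - Real.exp (-a k)|

/-- The variation of the sequence `exp (-a k)`. -/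
def variation (a : ℕ → ℝ) (k : ℕ) : ℝ := |Real.exp (-a (k + 1)) - Real.exp (-a k)|

theorem abs_sub_le_one_of_mem_Icc {x y : ℝ} (hx : x ∈ Set.Icc (0 : ℝ) 1)
    (hy : y ∈ Set.Icc (0 : ℝ) 1) : |x - y| ≤ 1 :=
  abs_le.2 ⟨by linarith [hx.1, hy.2], by linarith [hx.2, hy.1]⟩

theorem exp_neg_mem_Icc {x : ℝ} (hx : 0 ≤ x) : Real.exp (-x) ∈ Set.Icc (0 : ℝ) 1 :=
  ⟨(Real.exp_pos _).le, Real.exp_le_one_iff.2 (neg_nonpos.2 hx)⟩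

theorem deviation_le_one (ha : ∀ k, 0 ≤ a k) (k : ℕ) : deviation a k ≤ 1 :=
  abs_sub_le_one_of_mem_Icc (detRatio_mem_Icc a k) (exp_neg_mem_Icc (ha k))

theorem variation_le_one (ha : ∀ k, 0 ≤ a k) (k : ℕ) : variation a k ≤ 1 :=
  abs_sub_le_one_of_mem_Icc (exp_neg_mem_Icc (ha _)) (exp_neg_mem_Icc (ha k))

theorem abs_exp_neg_sub_exp_neg_le {x y : ℝ} (hx : 0 ≤ x) (hy : 0 ≤ y) :
    |Real.exp (-x) - Real.exp (-y)| ≤ |x - y| := by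
  wlog h : x ≤ y generalizing x y
  · rw [abs_sub_comm, abs_sub_comm x y]
    exact this hy hx (le_of_not_ge h)
  have hmono : Real.exp (-y) ≤ Real.exp (-x) := Real.exp_le_exp.2 (neg_le_neg h)
  have hfactor : Real.exp (-y) = Real.exp (-x) * Real.exp (x - y) := by
    rw [← Real.exp_add]
    ring_nf
  rw [abs_of_nonneg (sub_nonneg.2 hmono), abs_of_nonpos (sub_nonpos.2 h), hfactor]
  nlinarith [Real.add_one_le_exp (x - y), (exp_neg_mem_Icc hx).2, Real.exp_pos (-x)]

theorem deviation_succ_le (ha : ∀ k, σ ≤ a k) (k : ℕ) :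
    deviation a (k + 1) ≤ Real.exp (-σ) * (deviation a k + variation a k) := by
  obtain ⟨hr, hr'⟩ := detRatio_mem_Icc a (k + 1)
  have hm : Real.exp (-a (k + 1)) ≤ Real.exp (-σ) := Real.exp_le_exp.2 (neg_le_neg (ha _))
  rw [deviation, detRatio_succ_sub_exp_neg, abs_mul,
    abs_of_nonneg (mul_nonneg hr (Real.exp_pos _).le)]
  gcongr
  · exact (mul_le_of_le_one_left (Real.exp_pos _).le hr').trans hm
  · rw [variation, abs_sub_comm (Real.exp (-a (k + 1)))]
    exact abs_sub_le _ _ _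

theorem one_sub_exp_neg_le {r : ℝ} (hr : r ≤ 1) {x : ℝ} (hx : σ ≤ x) :
    1 - Real.exp (-σ) ≤ 1 - r * Real.exp (-x) :=
  sub_le_sub_left ((mul_le_of_le_one_left (Real.exp_pos _).le hr).trans
    (Real.exp_le_exp.2 (neg_le_neg hx))) 1

theorem abs_defect_le (hσ : 0 < σ) (ha : ∀ k, σ ≤ a k) (k : ℕ) :
    |defect a k| ≤ variation a k * deviation a k / (1 - Real.exp (-σ)) ^ 2 := by
  have hpos : 0 < 1 - Real.exp (-σ) := sub_pos.2 (exp_neg_lt_one hσ)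
  have h₁ := one_sub_exp_neg_le (detRatio_mem_Icc a k).2 (ha k)
  have h₂ := one_sub_exp_neg_le (exp_neg_mem_Icc (hσ.le.trans (ha k))).2 (ha (k + 1))
  rw [defect, abs_div, abs_mul, abs_sub_comm (Real.exp (-a k)) (detRatio a k), mul_comm, sq,
    abs_mul, abs_of_pos (hpos.trans_le h₁), abs_of_pos (hpos.trans_le h₂)]
  exact div_le_div_of_nonneg_left (by positivity) (by positivity)
    (mul_le_mul h₁ h₂ hpos.le (hpos.le.trans h₁))

end Deviation

theorem tendsto_prod_one_add_of_tendsto_sum_abs {α ι : Type*} {l : Filter α} {s : α → Finset ι}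
    {e : α → ι → ℝ} (h : Tendsto (fun n => ∑ k ∈ s n, |e n k|) l (𝓝 0)) :
    Tendsto (fun n => ∏ k ∈ s n, (1 + e n k)) l (𝓝 1) := by
  rw [tendsto_iff_norm_sub_tendsto_zero]
  have hexp : Tendsto (fun n => Real.exp (∑ k ∈ s n, |e n k|) - 1) l (𝓝 0) := by
    simpa using ((Real.continuous_exp.tendsto 0).comp h).sub_const 1
  exact squeeze_zero (fun n => norm_nonneg _)
    (fun n => (s n).norm_prod_one_add_sub_one_le (e n)) hexp

/-- A triangular array `a n k`, bounded below by `σ > 0`, whose steps in row `n` are at most `L / n`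
except at the positions `K j n`, which move away from each other and from the two ends of the row.
The entries with `k > n` only have to satisfy the lower bound. -/
structure StepArray {ι : Type*} (a : ℕ → ℕ → ℝ) (K : ι → ℕ → ℕ) (σ L : ℝ) : Prop where
  pos : 0 < σ
  nonneg : 0 ≤ L
  le : ∀ n k, σ ≤ a n k
  step : ∀ n k, k < n → (∀ j, K j n ≠ k) → |a n (k + 1) - a n k| ≤ L / n
  isolated : ∀ N j, ∀ᶠ n in atTop, N ≤ K j n ∧ K j n + N < n ∧
    ∀ j', j' ≠ j → K j n < K j' n ∨ K j' n + N < K j n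

namespace StepArray

variable {ι : Type*} {a : ℕ → ℕ → ℝ} {K : ι → ℕ → ℕ} {σ L : ℝ}

theorem entry_nonneg (h : StepArray a K σ L) (n k : ℕ) : 0 ≤ a n k :=
  h.pos.le.trans (h.le n k)

theorem variation_le (h : StepArray a K σ L) {n k : ℕ} (hk : k < n) (hK : ∀ j, K j n ≠ k) :
    variation (a n) k ≤ L / n :=
  (abs_exp_neg_sub_exp_neg_le (h.entry_nonneg _ _) (h.entry_nonneg _ _)).trans (h.step n k hk hK)

theorem tendsto_deviation (h : StepArray a K σ L) {κ : ℕ → ℕ}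
    (hκ : ∀ N, ∀ᶠ n in atTop, N ≤ κ n ∧ κ n ≤ n ∧ ∀ j, κ n ≤ K j n ∨ K j n + N < κ n) :
    Tendsto (fun n => deviation (a n) (κ n)) atTop (𝓝 0) := by
  have hρ := exp_neg_lt_one h.pos
  refine tendsto_order.2 ⟨fun x hx => Eventually.of_forall fun n => hx.trans_le (abs_nonneg _),
    fun x hx => ?_⟩
  obtain ⟨N, hN⟩ := exists_pow_lt_of_lt_one (half_pos hx) hρ
  have hL : Tendsto (fun n : ℕ => L / n / (1 - Real.exp (-σ))) atTop (𝓝 0) := by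
    simpa using (tendsto_const_div_atTop_nhds_zero_nat L).div_const (1 - Real.exp (-σ))
  filter_upwards [hκ N, hL.eventually_lt_const (half_pos hx)] with n ⟨hN_le, hle, hK⟩ hsmall
  have hcontr := le_pow_mul_add_div_of_contraction (Real.exp_pos _).le hρ
    (deviation_succ_le (h.le n)) (div_nonneg h.nonneg (Nat.cast_nonneg n)) (κ n - N) N
    fun i hi hi' => h.variation_le (by omega) fun j hj => by have := hK j; omega
  rw [Nat.sub_add_cancel hN_le] at hcontr
  have hpow := mul_le_of_le_one_right (pow_nonneg (Real.exp_pos (-σ)).le N)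
    (deviation_le_one (h.entry_nonneg n) (κ n - N))
  linarith

theorem tendsto_deviation_jump (h : StepArray a K σ L) (j : ι) :
    Tendsto (fun n => deviation (a n) (K j n)) atTop (𝓝 0) := by
  refine h.tendsto_deviation fun N => ?_
  filter_upwards [h.isolated N j] with n ⟨hN, hn, hK⟩
  refine ⟨hN, by omega, fun j' => ?_⟩
  rcases eq_or_ne j' j with rfl | hj
  · exact Or.inl le_rfl
  · exact (hK j' hj).imp_left le_of_lt

theorem tendsto_deviation_last [Finite ι] (h : StepArray a K σ L) :
    Tendsto (fun n => deviation (a n) n) atTop (𝓝 0) := by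
  refine h.tendsto_deviation fun N => ?_
  filter_upwards [eventually_ge_atTop N, eventually_all.2 (h.isolated N)] with n hn hK
  exact ⟨hn, le_rfl, fun j => Or.inr (hK j).2.1⟩

theorem tendsto_one_sub_div_one_sub [Finite ι] (h : StepArray a K σ L) :
    Tendsto (fun n => (1 - Real.exp (-a n n) ^ 2) / (1 - detRatio (a n) n * Real.exp (-a n n)))
      atTop (𝓝 1) := by
  have hρ : 0 < 1 - Real.exp (-σ) := sub_pos.2 (exp_neg_lt_one h.pos)
  have hdev := h.tendsto_deviation_last.div_const (1 - Real.exp (-σ))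
  rw [zero_div] at hdev
  refine tendsto_iff_norm_sub_tendsto_zero.2 <|
    squeeze_zero (fun n => norm_nonneg _) (fun n => ?_) hdev
  have hden := one_sub_exp_neg_le (detRatio_mem_Icc (a n) n).2 (h.le n n)
  obtain ⟨hm, hm'⟩ := exp_neg_mem_Icc (h.entry_nonneg n n)
  have hnum : 1 - Real.exp (-a n n) ^ 2 - (1 - detRatio (a n) n * Real.exp (-a n n)) =
      (detRatio (a n) n - Real.exp (-a n n)) * Real.exp (-a n n) := by ring
  rw [div_sub_one (hρ.trans_le hden).ne', hnum, Real.norm_eq_abs, abs_div, abs_mul,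
    abs_of_nonneg hm, abs_of_pos (hρ.trans_le hden)]
  exact div_le_div₀ (abs_nonneg _) (mul_le_of_le_one_right (abs_nonneg _) hm') hρ hden

theorem variation_le_add_sum [Fintype ι] (h : StepArray a K σ L) {n k : ℕ} (hk : k < n) :
    variation (a n) k ≤ L / n + ∑ j, if K j n = k then 1 else 0 := by
  have hL : 0 ≤ L / n := div_nonneg h.nonneg (Nat.cast_nonneg _)
  have hind (j : ι) : (0 : ℝ) ≤ if K j n = k then 1 else 0 := by positivity
  by_cases hK : ∀ j, K j n ≠ k
  · exact (h.variation_le hk hK).trans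
      (le_add_of_nonneg_right (Finset.sum_nonneg fun j _ => hind j))
  · push Not at hK
    obtain ⟨j, hj⟩ := hK
    calc variation (a n) k ≤ if K j n = k then 1 else 0 := by
          rw [if_pos hj]
          exact variation_le_one (h.entry_nonneg n) k
      _ ≤ ∑ j, if K j n = k then 1 else 0 :=
          Finset.single_le_sum (fun j _ => hind j) (Finset.mem_univ j)
      _ ≤ _ := le_add_of_nonneg_left hL

theorem sum_variation_mul_le [Fintype ι] (h : StepArray a K σ L) (n : ℕ) {e : ℕ → ℝ}
    (he : ∀ k, 0 ≤ e k) :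
    ∑ k ∈ Finset.range n, variation (a n) k * e k ≤
      L / n * ∑ k ∈ Finset.range n, e k + ∑ j, e (K j n) := by
  calc ∑ k ∈ Finset.range n, variation (a n) k * e k
      ≤ ∑ k ∈ Finset.range n, (L / n * e k + ∑ j, if K j n = k then e k else 0) := by
        refine Finset.sum_le_sum fun k hk => ?_
        have hmul := mul_le_mul_of_nonneg_right (h.variation_le_add_sum (Finset.mem_range.1 hk))
          (he k)
        simpa only [add_mul, Finset.sum_mul, ite_mul, one_mul, zero_mul] using hmul
    _ ≤ _ := by
        rw [Finset.sum_add_distrib, ← Finset.mul_sum, Finset.sum_comm]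
        gcongr with j
        rw [Finset.sum_ite_eq]
        split_ifs
        exacts [le_rfl, he _]

theorem sum_deviation_le [Fintype ι] (h : StepArray a K σ L) (n : ℕ) :
    ∑ k ∈ Finset.range n, deviation (a n) k ≤
      (1 + (L + Fintype.card ι)) / (1 - Real.exp (-σ)) := by
  have hρ := exp_neg_lt_one h.pos
  have hcontr := sum_le_of_contraction hρ.le (deviation_succ_le (h.le n))
    (fun k => abs_nonneg _) n
  have hvar : ∑ k ∈ Finset.range n, variation (a n) k ≤ L + Fintype.card ι := by
    have hsum := h.sum_variation_mul_le n (e := fun _ => 1) fun _ => zero_le_one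
    simp only [mul_one, Finset.sum_const, Finset.card_range, nsmul_eq_mul,
      Finset.card_univ] at hsum
    rw [div_mul_comm] at hsum
    exact hsum.trans (by gcongr; exact mul_le_of_le_one_left h.nonneg (div_self_le_one _))
  rw [le_div_iff₀ (sub_pos.2 hρ), mul_comm]
  have hlast : 0 ≤ deviation (a n) n := abs_nonneg _
  linarith [deviation_le_one (h.entry_nonneg n) 0]

theorem sum_abs_defect_le [Fintype ι] (h : StepArray a K σ L) (n : ℕ) :
    ∑ k ∈ Finset.range n, |defect (a n) k| ≤
      (L / n * ((1 + (L + Fintype.card ι)) / (1 - Real.exp (-σ))) +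
        ∑ j, deviation (a n) (K j n)) / (1 - Real.exp (-σ)) ^ 2 := by
  have hL : 0 ≤ L / n := div_nonneg h.nonneg (Nat.cast_nonneg _)
  calc ∑ k ∈ Finset.range n, |defect (a n) k|
      ≤ (∑ k ∈ Finset.range n, variation (a n) k * deviation (a n) k) /
          (1 - Real.exp (-σ)) ^ 2 := by
        rw [Finset.sum_div]
        exact Finset.sum_le_sum fun k _ => abs_defect_le h.pos (h.le n) k
    _ ≤ _ := by
        gcongr
        refine (h.sum_variation_mul_le n (e := deviation (a n)) fun k => abs_nonneg _).trans ?_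
        gcongr
        exact h.sum_deviation_le n

theorem tendsto_prod_one_add_defect [Finite ι] (h : StepArray a K σ L) :
    Tendsto (fun n => ∏ k ∈ Finset.range n, (1 + defect (a n) k)) atTop (𝓝 1) := by
  cases nonempty_fintype ι
  refine tendsto_prod_one_add_of_tendsto_sum_abs <|
    squeeze_zero (fun n => Finset.sum_nonneg fun k _ => abs_nonneg _) h.sum_abs_defect_le ?_
  have hL := (tendsto_const_div_atTop_nhds_zero_nat L).mul_const
    ((1 + (L + Fintype.card ι)) / (1 - Real.exp (-σ)))
  have hjump := tendsto_finsetSum Finset.univ fun j _ => h.tendsto_deviation_jump j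
  simpa using (hL.add hjump).div_const ((1 - Real.exp (-σ)) ^ 2)

end StepArray

/-- The constant `α` in the coordinates `f(0) = 2 cosh x` and `f(1) = 2 cosh y`. -/
def endpointFactor (x y : ℝ) : ℝ := Real.exp y / (2 * √(Real.sinh x * Real.sinh y))

theorem sqrt_sinh_div_sinh {x y : ℝ} (hx : 0 < x) (hy : 0 < y) :
    √(Real.sinh y / Real.sinh x) = endpointFactor x y * (1 - Real.exp (-y) ^ 2) := by
  have hsx := (Real.sqrt_pos.2 (Real.sinh_pos_iff.2 hx)).ne'
  have hsy := (Real.sqrt_pos.2 (Real.sinh_pos_iff.2 hy)).ne'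
  have hexp : Real.exp y * Real.exp (-y) = 1 := by simp [← Real.exp_add]
  have hsq : √(Real.sinh y) ^ 2 * 2 = Real.exp y * (1 - Real.exp (-y) ^ 2) := by
    rw [Real.sq_sqrt (Real.sinh_pos_iff.2 hy).le, Real.sinh_eq]
    linear_combination Real.exp (-y) * hexp
  rw [endpointFactor, Real.sqrt_mul (Real.sinh_pos_iff.2 hx).le,
    Real.sqrt_div (Real.sinh_pos_iff.2 hy).le, div_mul_eq_mul_div, ← hsq]
  field_simp

theorem StepArray.isEquivalent_det_tridiag {ι : Type*} [Finite ι] {a : ℕ → ℕ → ℝ}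
    {K : ι → ℕ → ℕ} {σ L : ℝ} (h : StepArray a K σ L) :
    Asymptotics.IsEquivalent atTop (fun n => (tridiag (fun i => 2 * Real.cosh (a n i)) n).det)
      fun n => endpointFactor (a n 0) (a n n) *
        ∏ k ∈ Finset.range n, Real.exp (a n (k + 1)) * transmission (a n k) (a n (k + 1)) := by
  refine Asymptotics.isEquivalent_iff_exists_eq_mul.2 ⟨_,
    by simpa using h.tendsto_prod_one_add_defect.mul h.tendsto_one_sub_div_one_sub,
    Eventually.of_forall fun n => ?_⟩
  have ha (k : ℕ) : 0 < a n k := h.pos.trans_le (h.le n k)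
  have hden := (one_sub_detRatio_mul_exp_neg_pos (a n) n (ha n)).ne'
  simp only [Pi.mul_apply]
  rw [eq_div_of_mul_eq hden (det_tridiag_mul_one_sub ha n), sqrt_sinh_div_sinh (ha 0) (ha n)]
  ring

section Transmission

theorem tendsto_transmission {α : Type*} {l : Filter α} {u v : α → ℝ} {x y : ℝ} (hx : 0 < x)
    (hy : 0 < y) (hu : Tendsto u l (𝓝 x)) (hv : Tendsto v l (𝓝 y)) :
    Tendsto (fun n => transmission (u n) (v n)) l (𝓝 (transmission x y)) := by
  have hsinh := mul_pos (Real.sinh_pos_iff.2 hx) (Real.sinh_pos_iff.2 hy)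
  have hcont {z : ℝ} {w : α → ℝ} (hw : Tendsto w l (𝓝 z)) :
      Tendsto (fun n => Real.sinh (w n)) l (𝓝 (Real.sinh z)) :=
    (Real.continuous_sinh.tendsto z).comp hw
  exact (hu.rexp.sub hv.neg.rexp).div (((hcont hu).mul (hcont hv)).sqrt.const_mul 2)
    (mul_pos two_pos (Real.sqrt_pos.2 hsinh)).ne'

theorem transmission_sq {x y : ℝ} (hx : 0 < x) (hy : 0 < y) :
    transmission x y ^ 2 = Real.exp (x - y) * (1 + (Real.exp (-x) - Real.exp (-y)) ^ 2 /
      ((1 - Real.exp (-x) * Real.exp (-x)) * (1 - Real.exp (-y) * Real.exp (-y)))) := by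
  have hmx := (one_sub_exp_neg_mul_exp_neg_pos hx hx).ne'
  have hmy := (one_sub_exp_neg_mul_exp_neg_pos hy hy).ne'
  have hpx := Real.exp_ne_zero (-x)
  have hpy := Real.exp_ne_zero (-y)
  have hsinh := mul_pos (Real.sinh_pos_iff.2 hx) (Real.sinh_pos_iff.2 hy)
  have hinv (z : ℝ) : Real.exp z = (Real.exp (-z))⁻¹ := by rw [Real.exp_neg, inv_inv]
  have hsinh_eq (z : ℝ) :
      Real.sinh z = (1 - Real.exp (-z) * Real.exp (-z)) / (2 * Real.exp (-z)) := by
    rw [Real.sinh_eq, hinv z]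
    field_simp
  rw [transmission, div_pow, mul_pow, Real.sq_sqrt hsinh.le, hsinh_eq, hsinh_eq, Real.exp_sub,
    hinv x, hinv y, one_add_div (mul_ne_zero hmx hmy)]
  generalize Real.exp (-x) = p, Real.exp (-y) = q at *
  rw [div_mul_div_comm, mul_div_assoc', div_div_eq_mul_div, mul_div_assoc',
    div_eq_div_iff (mul_ne_zero (pow_ne_zero 2 two_ne_zero) (mul_ne_zero hmx hmy))
      (mul_ne_zero hmx hmy)]
  field_simp
  ring

theorem abs_log_transmission_sub_le {σ x y : ℝ} (hσ : 0 < σ) (hx : σ ≤ x) (hy : σ ≤ y) :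
    |Real.log (transmission x y) - (x - y) / 2| ≤ (x - y) ^ 2 / (1 - Real.exp (-σ)) ^ 2 := by
  have hx₀ := hσ.trans_le hx
  have hy₀ := hσ.trans_le hy
  have hpos : 0 < 1 - Real.exp (-σ) := sub_pos.2 (exp_neg_lt_one hσ)
  have hmx := one_sub_exp_neg_le (exp_neg_mem_Icc hx₀.le).2 hx
  have hmy := one_sub_exp_neg_le (exp_neg_mem_Icc hy₀.le).2 hy
  obtain ⟨q, hq⟩ : ∃ q, q = (Real.exp (-x) - Real.exp (-y)) ^ 2 /
    ((1 - Real.exp (-x) * Real.exp (-x)) * (1 - Real.exp (-y) * Real.exp (-y))) := ⟨_, rfl⟩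
  have hq_nonneg : 0 ≤ q :=
    hq ▸ div_nonneg (sq_nonneg _) (mul_pos (hpos.trans_le hmx) (hpos.trans_le hmy)).le
  have hq_le : q ≤ (x - y) ^ 2 / (1 - Real.exp (-σ)) ^ 2 := by
    rw [hq, sq (1 - Real.exp (-σ))]
    exact div_le_div₀ (sq_nonneg _) (sq_le_sq.2 (abs_exp_neg_sub_exp_neg_le hx₀.le hy₀.le))
      (mul_pos hpos hpos) (mul_le_mul hmx hmy hpos.le (hpos.le.trans hmx))
  have hlog : 2 * Real.log (transmission x y) = (x - y) + Real.log (1 + q) := by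
    have hsq := congrArg Real.log (hq ▸ transmission_sq hx₀ hy₀)
    rwa [Real.log_pow, Real.log_mul (Real.exp_pos _).ne' (by positivity), Real.log_exp] at hsq
  have hlog_nonneg : 0 ≤ Real.log (1 + q) := Real.log_nonneg (by linarith)
  have hlog_le : Real.log (1 + q) ≤ q := by
    linarith [Real.log_le_sub_one_of_pos (show 0 < 1 + q by positivity)]
  rw [show Real.log (transmission x y) - (x - y) / 2 = Real.log (1 + q) / 2 by linarith,
    abs_of_nonneg (by positivity)]
  linarith

end Transmission

theorem tendsto_prod_of_abs_log_le {s : ℕ → Finset ℕ} {F : ℕ → ℕ → ℝ} {C : ℝ}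
    (hs : ∀ n, s n ⊆ Finset.range n) (hF : ∀ n, ∀ k ∈ s n, 0 < F n k) (hC : 0 ≤ C)
    (hlog : ∀ n, ∀ k ∈ s n, |Real.log (F n k)| ≤ C / n ^ 2) :
    Tendsto (fun n => ∏ k ∈ s n, F n k) atTop (𝓝 1) := by
  have hsum : Tendsto (fun n => ∑ k ∈ s n, Real.log (F n k)) atTop (𝓝 0) := by
    refine squeeze_zero_norm (fun n => ?_) (tendsto_const_div_atTop_nhds_zero_nat C)
    calc ‖∑ k ∈ s n, Real.log (F n k)‖
        ≤ ∑ _k ∈ s n, C / (n : ℝ) ^ 2 := norm_sum_le_of_le _ (hlog n)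
      _ ≤ ∑ _k ∈ Finset.range n, C / (n : ℝ) ^ 2 :=
          Finset.sum_le_sum_of_subset_of_nonneg (hs n) fun _ _ _ => by positivity
      _ = C / n := by
          rw [Finset.sum_const, Finset.card_range, nsmul_eq_mul]
          rcases n.eq_zero_or_pos with rfl | hn
          · simp
          · field_simp
  have hexp := (Real.continuous_exp.tendsto 0).comp hsum
  rw [Real.exp_zero] at hexp
  refine hexp.congr fun n => ?_
  rw [Function.comp, Real.exp_sum]
  exact Finset.prod_congr rfl fun k hk => Real.exp_log (hF n k hk)

section PiecewiseRegularity

theorem isBounded_image_diff_of_hasDerivWithinAt {E : Type*} [NormedAddCommGroup E]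
    [NormedSpace ℝ E] {h h' : ℝ → E} {M : ℝ} {C I : Set ℝ} (hC : C.Finite) (hI : Convex ℝ I)
    (hbdd : Bornology.IsBounded I)
    (hderiv : ∀ x ∈ I \ C, HasDerivWithinAt h (h' x) (I \ C) x)
    (hM : ∀ x ∈ I \ C, ‖h' x‖ ≤ M) :
    Bornology.IsBounded (h '' (I \ C)) := by
  induction C, hC using Set.Finite.induction_on generalizing I with
  | empty =>
    simp only [Set.sdiff_empty] at hderiv hM ⊢
    obtain ⟨d, hd⟩ := Metric.isBounded_iff.1 hbdd
    refine Metric.isBounded_image_iff.2 ⟨M * d, fun x hx y hy => ?_⟩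
    have hM₀ : 0 ≤ M := (norm_nonneg _).trans (hM x hx)
    calc dist (h x) (h y) ≤ M * dist x y := by
          simpa only [dist_eq_norm] using
            hI.norm_image_sub_le_of_norm_hasDerivWithin_le hderiv hM hy hx
      _ ≤ M * d := mul_le_mul_of_nonneg_left (hd hx hy) hM₀
  | @insert c C _ _ ih =>
    have hsplit : I \ insert c C = (I ∩ Set.Iio c) \ C ∪ (I ∩ Set.Ioi c) \ C := by
      ext x
      simp only [Set.mem_sdiff, Set.mem_insert_iff, Set.mem_union, Set.mem_inter_iff, Set.mem_Iio,
        Set.mem_Ioi, not_or, ← ne_eq, ← lt_or_lt_iff_ne]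
      tauto
    have hpart {J : Set ℝ} (hJ : Convex ℝ J) (hsub : (I ∩ J) \ C ⊆ I \ insert c C) :
        Bornology.IsBounded (h '' ((I ∩ J) \ C)) :=
      ih (hI.inter hJ) (hbdd.subset Set.inter_subset_left)
        (fun x hx => (hderiv x (hsub hx)).mono hsub) fun x hx => hM x (hsub hx)
    rw [hsplit, Set.image_union]
    exact (hpart (convex_Iio c) (hsplit ▸ Set.subset_union_left)).union
      (hpart (convex_Ioi c) (hsplit ▸ Set.subset_union_right))

theorem TwiceDiffBddOn.comp {f φ : ℝ → ℝ} {C I U : Set ℝ} (hf : TwiceDiffBddOn f (I \ C))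
    (hC : C.Finite) (hI : Convex ℝ I) (hbdd : Bornology.IsBounded I) (hU : IsOpen U)
    (hφ : ContDiffOn ℝ 2 φ U) (hfU : closure (f '' (I \ C)) ⊆ U) :
    TwiceDiffBddOn (φ ∘ f) (I \ C) := by
  obtain ⟨f₁, f₂, M, hf⟩ := hf
  have hf₁_bdd := isBounded_image_diff_of_hasDerivWithinAt hC hI hbdd
    (fun x hx => (hf x hx).2.1) fun x hx => (hf x hx).2.2
  obtain ⟨B, hB⟩ := hf₁_bdd.exists_norm_le
  have hf₁_le : ∀ x ∈ I \ C, |f₁ x| ≤ B := fun x hx => hB _ (Set.mem_image_of_mem f₁ hx)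
  have hK : IsCompact (closure (f '' (I \ C))) :=
    (isBounded_image_diff_of_hasDerivWithinAt hC hI hbdd
      (fun x hx => (hf x hx).1) hf₁_le).isCompact_closure
  have hmem : ∀ x ∈ I \ C, f x ∈ closure (f '' (I \ C)) := fun x hx =>
    subset_closure (Set.mem_image_of_mem f hx)
  have hφ₁ : ContDiffOn ℝ 1 (deriv φ) U := hφ.deriv_of_isOpen hU (by norm_num)
  obtain ⟨A₁, hA₁⟩ := hK.exists_bound_of_continuousOn (hφ₁.continuousOn.mono hfU)
  obtain ⟨A₂, hA₂⟩ := hK.exists_bound_of_continuousOn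
    ((hφ₁.continuousOn_deriv_of_isOpen hU le_rfl).mono hfU)
  refine ⟨fun x => deriv φ (f x) * f₁ x,
    fun x => deriv (deriv φ) (f x) * f₁ x * f₁ x + deriv φ (f x) * f₂ x,
    A₂ * B * B + A₁ * M, fun x hx => ?_⟩
  obtain ⟨hd₁, hd₂, hM⟩ := hf x hx
  have hUx : U ∈ 𝓝 (f x) := hU.mem_nhds (hfU (hmem x hx))
  have hφ_deriv := ((hφ.differentiableOn two_ne_zero).differentiableAt hUx).hasDerivAt
  have hφ₁_deriv := ((hφ₁.differentiableOn one_ne_zero).differentiableAt hUx).hasDerivAt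
  have h₁ : |deriv φ (f x)| ≤ A₁ := hA₁ _ (hmem x hx)
  have h₂ : |deriv (deriv φ) (f x)| ≤ A₂ := hA₂ _ (hmem x hx)
  refine ⟨hφ_deriv.comp_hasDerivWithinAt x hd₁,
    (hφ₁_deriv.comp_hasDerivWithinAt x hd₁).mul hd₂, (abs_add_le _ _).trans ?_⟩
  rw [abs_mul, abs_mul, abs_mul]
  have hA₁_nonneg : 0 ≤ A₁ := (abs_nonneg _).trans h₁
  have hA₂_nonneg : 0 ≤ A₂ := (abs_nonneg _).trans h₂
  have hB_nonneg : 0 ≤ B := (abs_nonneg _).trans (hf₁_le x hx)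
  gcongr <;> exact hf₁_le x hx

theorem exists_trapezoid_error_eq {g g₁ : ℝ → ℝ} {a b : ℝ} (hab : a < b)
    (hg : ContinuousOn g (Set.Icc a b)) (hderiv : ∀ x ∈ Set.Ioo a b, HasDerivAt g (g₁ x) x) :
    ∃ c ∈ Set.Ioo a b, (∫ x in a..b, g x) - (b - a) * (g a + g b) / 2 =
      (b - a) * (g c - (g a + g c + (c - a) * g₁ c) / 2) := by
  set F : ℝ → ℝ := fun x => (∫ t in a..x, g t) - (x - a) * (g a + g x) / 2 with hF
  have hcont_integral : ContinuousOn (fun x => ∫ t in a..x, g t) (Set.Icc a b) := by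
    simpa only [Set.uIcc_of_le hab.le] using
      intervalIntegral.continuousOn_primitive_interval (μ := volume) (f := g)
        (a := a) (b := b) (by simpa only [Set.uIcc_of_le hab.le] using hg.integrableOn_Icc)
  have hcont : ContinuousOn F (Set.Icc a b) :=
    hcont_integral.sub
      (((continuousOn_id.sub continuousOn_const).mul (continuousOn_const.add hg)).div_const 2)
  have hderiv_integral : ∀ x ∈ Set.Ioo a b, HasDerivAt (fun x => ∫ t in a..x, g t) (g x) x :=
    fun x hx => intervalIntegral.integral_hasDerivAt_right
      ((hg.mono (Set.Icc_subset_Icc_right hx.2.le)).intervalIntegrable_of_Icc hx.1.le)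
      ((hg.mono Set.Ioo_subset_Icc_self).stronglyMeasurableAtFilter isOpen_Ioo x hx)
      (hderiv x hx).continuousAt
  have hderiv_F : ∀ x ∈ Set.Ioo a b,
      HasDerivAt F (g x - (g a + g x + (x - a) * g₁ x) / 2) x := fun x hx =>
    ((hderiv_integral x hx).sub ((((hasDerivAt_id x).sub_const a).mul
      ((hderiv x hx).const_add (g a))).div_const 2)).congr_deriv (by simp only [id, one_mul])
  obtain ⟨c, hc, hslope⟩ := exists_hasDerivAt_eq_slope F _ hab hcont hderiv_F
  refine ⟨c, hc, ?_⟩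
  rw [hslope, mul_div_cancel₀ _ (sub_pos.2 hab).ne']
  simp only [hF, intervalIntegral.integral_same, sub_self, zero_mul, zero_div, sub_zero]

-- Unlike in `trapezoidal_error_le`, the derivatives need not exist at the endpoints, where the
-- function may cease to be smooth.
theorem abs_integral_sub_trapezoid_le {g g₁ g₂ : ℝ → ℝ} {a b M : ℝ} (hab : a < b)
    (hg : ContinuousOn g (Set.Icc a b)) (hderiv : ∀ x ∈ Set.Ioo a b, HasDerivAt g (g₁ x) x)
    (hderiv₂ : ∀ x ∈ Set.Ioo a b, HasDerivAt g₁ (g₂ x) x) (hM : ∀ x ∈ Set.Ioo a b, |g₂ x| ≤ M) :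
    |(∫ x in a..b, g x) - (b - a) * (g a + g b) / 2| ≤ M * (b - a) ^ 3 := by
  obtain ⟨c, hc, hF⟩ := exists_trapezoid_error_eq hab hg hderiv
  obtain ⟨d, hd, hg_slope⟩ := exists_hasDerivAt_eq_slope g g₁ hc.1
    (hg.mono (Set.Icc_subset_Icc_right hc.2.le)) fun x hx => hderiv x ⟨hx.1, hx.2.trans hc.2⟩
  have hIcc : Set.Icc d c ⊆ Set.Ioo a b := Set.Icc_subset_Ioo hd.1 hc.2
  obtain ⟨e, he, hg₁_slope⟩ := exists_hasDerivAt_eq_slope g₁ g₂ hd.2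
    (fun x hx => (hderiv₂ x (hIcc hx)).continuousAt.continuousWithinAt)
    fun x hx => hderiv₂ x (hIcc (Set.Ioo_subset_Icc_self hx))
  have hca : 0 < c - a := sub_pos.2 hc.1
  have hcd : 0 < c - d := sub_pos.2 hd.2
  have hba : 0 < b - a := sub_pos.2 hab
  rw [eq_div_iff hca.ne'] at hg_slope
  rw [eq_div_iff hcd.ne'] at hg₁_slope
  have herror : (∫ x in a..b, g x) - (b - a) * (g a + g b) / 2 =
      -((b - a) * (c - a) * (c - d) / 2) * g₂ e := by
    linear_combination hF - (b - a) / 2 * hg_slope + (c - a) * (b - a) / 2 * hg₁_slope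
  have hM_e : |g₂ e| ≤ M := hM e (hIcc (Set.Ioo_subset_Icc_self he))
  have hM₀ : 0 ≤ M := (abs_nonneg _).trans hM_e
  rw [herror, abs_mul, abs_neg, abs_of_pos (by positivity)]
  calc (b - a) * (c - a) * (c - d) / 2 * |g₂ e|
      ≤ (b - a) * (c - a) * (c - d) * M := by
        gcongr
        exact half_le_self (by positivity)
    _ ≤ (b - a) * (b - a) * (b - a) * M := by
        gcongr
        · exact hc.2.le
        · exact hc.2.le
        · exact hd.1.le
    _ = M * (b - a) ^ 3 := by ring

theorem TwiceDiffBddOn.exists_cell_bounds {g : ℝ → ℝ} {C I : Set ℝ}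
    (hg : TwiceDiffBddOn g (I \ C)) (hC : C.Finite) (hI : Convex ℝ I)
    (hbdd : Bornology.IsBounded I) :
    ∃ L M : ℝ, 0 ≤ L ∧ 0 ≤ M ∧ ∀ a b, a < b → Set.Ioo a b ⊆ I \ C → ContinuousOn g (Set.Icc a b) →
      |g b - g a| ≤ L * (b - a) ∧
      |(∫ x in a..b, g x) - (b - a) * (g a + g b) / 2| ≤ M * (b - a) ^ 3 := by
  obtain ⟨g₁, g₂, M, hg⟩ := hg
  obtain ⟨B, hB₀, hB⟩ := (isBounded_image_diff_of_hasDerivWithinAt hC hI hbdd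
    (fun x hx => (hg x hx).2.1) fun x hx => (hg x hx).2.2).exists_pos_norm_le
  refine ⟨B, |M|, hB₀.le, abs_nonneg M, fun a b hab hsub hcont => ?_⟩
  have hnhds : ∀ x ∈ Set.Ioo a b, I \ C ∈ 𝓝 x := fun x hx =>
    mem_of_superset (isOpen_Ioo.mem_nhds hx) hsub
  have hderiv : ∀ x ∈ Set.Ioo a b, HasDerivAt g (g₁ x) x := fun x hx =>
    (hg x (hsub hx)).1.hasDerivAt (hnhds x hx)
  constructor
  · obtain ⟨z, hz, hslope⟩ := exists_hasDerivAt_eq_slope _ _ hab hcont hderiv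
    have hba : 0 < b - a := sub_pos.2 hab
    rw [eq_div_iff hba.ne'] at hslope
    rw [← hslope, abs_mul, abs_of_pos hba]
    exact mul_le_mul_of_nonneg_right (hB _ (Set.mem_image_of_mem g₁ (hsub hz))) hba.le
  · exact abs_integral_sub_trapezoid_le hab hcont hderiv
      (fun x hx => (hg x (hsub hx)).2.1.hasDerivAt (hnhds x hx))
      fun x hx => (hg x (hsub hx)).2.2.trans (le_abs_self M)

end PiecewiseRegularity

section JumpIndex

/-- The grid cell containing the jump point `x`, in units of the mesh: the integer `k` with
`x ∈ (k, k + 1]` if `p` holds (right-continuity) and with `x ∈ [k, k + 1)` otherwise, so that a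
function has its left value at `k` and its right value at `k + 1` even if one of them is `x`. -/
def jumpIndex (p : Prop) [Decidable p] (x : ℝ) : ℕ := if p then ⌈x⌉₊ - 1 else ⌊x⌋₊

/-- The position of the jump point `x` in its grid cell: `{x}'` if `p` holds (right-continuity) and
`{x}` otherwise. -/
def jumpFract (p : Prop) [Decidable p] (x : ℝ) : ℝ := if p then fract' x else Int.fract x

variable {p : Prop} [Decidable p]

theorem jumpIndex_add_jumpFract {x : ℝ} (hx : 0 < x) : jumpIndex p x + jumpFract p x = x := by
  unfold jumpIndex jumpFract
  split_ifs
  · rw [Nat.cast_pred (Nat.ceil_pos.2 hx), natCast_ceil_eq_intCast_ceil hx.le, fract']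
    ring
  · rw [natCast_floor_eq_intCast_floor hx.le, Int.floor_add_fract]

theorem jumpFract_nonneg (x : ℝ) : 0 ≤ jumpFract p x := by
  unfold jumpFract fract'
  split_ifs
  · linarith [Int.ceil_lt_add_one x]
  · exact Int.fract_nonneg x

theorem jumpFract_le_one (x : ℝ) : jumpFract p x ≤ 1 := by
  unfold jumpFract fract'
  split_ifs
  · linarith [Int.le_ceil x]
  · exact (Int.fract_lt_one x).le

theorem jumpFract_pos (hp : p) (x : ℝ) : 0 < jumpFract p x := by
  rw [jumpFract, if_pos hp, fract']
  linarith [Int.ceil_lt_add_one x]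

theorem jumpFract_lt_one (hp : ¬p) (x : ℝ) : jumpFract p x < 1 := by
  rw [jumpFract, if_neg hp]
  exact Int.fract_lt_one x

theorem jumpIndex_eq_of_lt_of_lt {x : ℝ} {k : ℕ} (hk : k < x) (hk' : x < k + 1) :
    jumpIndex p x = k := by
  have hx : 0 ≤ x := k.cast_nonneg.trans hk.le
  unfold jumpIndex
  split_ifs
  · rw [(Nat.ceil_eq_iff k.succ_ne_zero).2 ⟨by simpa using hk, by simpa using hk'.le⟩,
      Nat.succ_sub_one]
  · exact (Nat.floor_eq_iff hx).2 ⟨hk.le, hk'⟩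

theorem jumpIndex_natCast (hp : ¬p) (k : ℕ) : jumpIndex p (k : ℝ) = k := by
  rw [jumpIndex, if_neg hp, Nat.floor_natCast]

theorem jumpIndex_natCast_add_one (hp : p) (k : ℕ) : jumpIndex p (k + 1 : ℝ) = k := by
  rw [jumpIndex, if_pos hp, ← Nat.cast_add_one, Nat.ceil_natCast, Nat.add_sub_cancel]

theorem jumpIndex_div_eq {c : ℝ} (hc : 0 < c) {n : ℕ} (hn : 0 < n) :
    (jumpIndex p (n * c) / n : ℝ) = c - jumpFract p (n * c) / n := by
  have hn' : (0 : ℝ) < n := Nat.cast_pos.2 hn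
  rw [eq_sub_iff_add_eq, ← add_div, jumpIndex_add_jumpFract (mul_pos hn' hc),
    mul_div_cancel_left₀ _ hn'.ne']

theorem jumpIndex_succ_div_eq {c : ℝ} (hc : 0 < c) {n : ℕ} (hn : 0 < n) :
    ((jumpIndex p (n * c) + 1 : ℕ) / n : ℝ) = c + (1 - jumpFract p (n * c)) / n := by
  rw [Nat.cast_add_one, add_div, jumpIndex_div_eq hc hn]
  ring

theorem tendsto_jumpIndex_div {c : ℝ} (hc : 0 < c) :
    Tendsto (fun n : ℕ => (jumpIndex p (n * c) / n : ℝ)) atTop (𝓝 c) := by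
  have hfract : Tendsto (fun n : ℕ => jumpFract p (n * c) / n) atTop (𝓝 0) :=
    squeeze_zero (fun n => div_nonneg (jumpFract_nonneg _) n.cast_nonneg)
      (fun n => div_le_div_of_nonneg_right (jumpFract_le_one _) n.cast_nonneg)
      (tendsto_const_div_atTop_nhds_zero_nat 1)
  have hlim := hfract.const_sub c
  rw [sub_zero] at hlim
  refine hlim.congr' ?_
  filter_upwards [eventually_gt_atTop 0] with n hn using (jumpIndex_div_eq hc hn).symm

theorem tendsto_jumpIndex_succ_div {c : ℝ} (hc : 0 < c) :
    Tendsto (fun n : ℕ => ((jumpIndex p (n * c) + 1 : ℕ) / n : ℝ)) atTop (𝓝 c) := by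
  have hlim := (tendsto_jumpIndex_div (p := p) hc).add
    (tendsto_const_div_atTop_nhds_zero_nat (1 : ℝ))
  rw [add_zero] at hlim
  refine hlim.congr fun n => ?_
  rw [Nat.cast_add_one, add_div]

theorem tendsto_jumpIndex_div_nhdsLE {c : ℝ} (hc : 0 < c) :
    Tendsto (fun n : ℕ => (jumpIndex p (n * c) / n : ℝ)) atTop (𝓝[≤] c) := by
  refine tendsto_nhdsWithin_iff.2 ⟨tendsto_jumpIndex_div hc, ?_⟩
  filter_upwards [eventually_gt_atTop 0] with n hn
  rw [jumpIndex_div_eq hc hn]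
  exact sub_le_self _ (div_nonneg (jumpFract_nonneg _) n.cast_nonneg)

theorem tendsto_jumpIndex_succ_div_nhdsGE {c : ℝ} (hc : 0 < c) :
    Tendsto (fun n : ℕ => ((jumpIndex p (n * c) + 1 : ℕ) / n : ℝ)) atTop (𝓝[≥] c) := by
  refine tendsto_nhdsWithin_iff.2 ⟨tendsto_jumpIndex_succ_div hc, ?_⟩
  filter_upwards [eventually_gt_atTop 0] with n hn
  rw [jumpIndex_succ_div_eq hc hn]
  exact le_add_of_nonneg_right (div_nonneg (sub_nonneg.2 (jumpFract_le_one _)) n.cast_nonneg)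

theorem notMem_Ioo_of_jumpIndex_ne {c : ℝ} {n k : ℕ} (hn : 0 < n)
    (hk : jumpIndex p (n * c) ≠ k) : c ∉ Set.Ioo (k / n : ℝ) ((k + 1 : ℕ) / n) := by
  have hn' : (0 : ℝ) < n := Nat.cast_pos.2 hn
  rintro ⟨hlt, hlt'⟩
  rw [div_lt_iff₀' hn'] at hlt
  rw [lt_div_iff₀' hn', Nat.cast_add_one] at hlt'
  exact hk (jumpIndex_eq_of_lt_of_lt hlt hlt')

end JumpIndex

theorem tendsto_mul_integral_sub_of_tendsto_ae {g : ℝ → ℝ} {u v : ℕ → ℝ} {a b B : ℝ}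
    {l l' : Filter ℝ} [intervalIntegral.FTCFilter a l l'] (hmeas : StronglyMeasurableAtFilter g l')
    (hg : Tendsto g (l' ⊓ ae volume) (𝓝 b))
    (hu : Tendsto u atTop l) (hv : Tendsto v atTop l)
    (hlength : ∀ᶠ n : ℕ in atTop, |n * (v n - u n)| ≤ B) :
    Tendsto (fun n : ℕ => n * (∫ x in u n..v n, g x) - n * (v n - u n) * b) atTop (𝓝 0) := by
  have hmul := (Asymptotics.isBigO_refl (fun n : ℕ => (n : ℝ)) atTop).mul_isLittleO
    (intervalIntegral.integral_sub_linear_isLittleO_of_tendsto_ae hmeas hg hu hv)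
  have hbdd : (fun n : ℕ => (n : ℝ) * (v - u) n) =O[atTop] fun _ => (1 : ℝ) := by
    refine Asymptotics.isBigO_iff.2 ⟨B, ?_⟩
    simpa only [norm_one, mul_one, Real.norm_eq_abs, Pi.sub_apply] using hlength
  refine ((Asymptotics.isLittleO_one_iff ℝ).1 (hmul.trans_isBigO hbdd)).congr fun n => ?_
  rw [smul_eq_mul]
  ring

theorem eventually_intervalIntegrable_of_integrableAtFilter {ι : Type*} {l : Filter ι} {g : ℝ → ℝ}
    {c : ℝ} (hg : IntegrableAtFilter g (𝓝 c)) {u v : ι → ℝ}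
    (hu : Tendsto u l (𝓝 c)) (hv : Tendsto v l (𝓝 c)) :
    ∀ᶠ i in l, IntervalIntegrable g volume (u i) (v i) := by
  obtain ⟨s, hs, hgs⟩ := hg
  filter_upwards [(hu.uIcc hv).eventually (eventually_smallSets.2 ⟨s, hs, fun _ => id⟩)]
    with i hi using (hgs.mono_set hi).intervalIntegrable

/-- `g` has one-sided limits `l` and `u` at `c`, and is right-continuous there if `p` holds and
left-continuous otherwise. -/
structure HasJump (p : Prop) (g : ℝ → ℝ) (c l u : ℝ) : Prop where
  tendsto_left : Tendsto g (𝓝[<] c) (𝓝 l)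
  tendsto_right : Tendsto g (𝓝[>] c) (𝓝 u)
  eq_left : ¬p → g c = l
  eq_right : p → g c = u

namespace HasJump

variable {p : Prop} {g : ℝ → ℝ} {c l u : ℝ}

theorem comp (h : HasJump p g c l u) {φ : ℝ → ℝ} (hl : ContinuousAt φ l)
    (hu : ContinuousAt φ u) : HasJump p (φ ∘ g) c (φ l) (φ u) where
  tendsto_left := hl.tendsto.comp h.tendsto_left
  tendsto_right := hu.tendsto.comp h.tendsto_right
  eq_left hp := congrArg φ (h.eq_left hp)
  eq_right hp := congrArg φ (h.eq_right hp)

theorem left_mem (h : HasJump p g c l u) {K : Set ℝ} (hK : IsClosed K)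
    (hg : ∀ᶠ x in 𝓝 c, g x ∈ K) : l ∈ K :=
  hK.mem_of_tendsto h.tendsto_left (hg.filter_mono nhdsWithin_le_nhds)

theorem right_mem (h : HasJump p g c l u) {K : Set ℝ} (hK : IsClosed K)
    (hg : ∀ᶠ x in 𝓝 c, g x ∈ K) : u ∈ K :=
  hK.mem_of_tendsto h.tendsto_right (hg.filter_mono nhdsWithin_le_nhds)

theorem continuousWithinAt_Iic (h : HasJump p g c l u) (hp : ¬p) :
    ContinuousWithinAt g (Set.Iic c) c := by
  rw [← continuousWithinAt_Iio_iff_Iic, ContinuousWithinAt, h.eq_left hp]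
  exact h.tendsto_left

theorem continuousWithinAt_Ici (h : HasJump p g c l u) (hp : p) :
    ContinuousWithinAt g (Set.Ici c) c := by
  rw [← continuousWithinAt_Ioi_iff_Ici, ContinuousWithinAt, h.eq_right hp]
  exact h.tendsto_right

theorem tendsto_jumpIndex_div [Decidable p] (h : HasJump p g c l u) (hc : 0 < c) :
    Tendsto (fun n : ℕ => g (jumpIndex p (n * c) / n)) atTop (𝓝 l) := by
  by_cases hp : p
  · refine h.tendsto_left.comp
      (tendsto_nhdsWithin_iff.2 ⟨DiscreteSchrodinger.tendsto_jumpIndex_div hc, ?_⟩)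
    filter_upwards [eventually_gt_atTop 0] with n hn
    rw [jumpIndex_div_eq hc hn]
    exact sub_lt_self _ (div_pos (jumpFract_pos hp _) (Nat.cast_pos.2 hn))
  · rw [← h.eq_left hp]
    exact (h.continuousWithinAt_Iic hp).tendsto.comp (tendsto_jumpIndex_div_nhdsLE hc)

theorem tendsto_jumpIndex_succ_div [Decidable p] (h : HasJump p g c l u) (hc : 0 < c) :
    Tendsto (fun n : ℕ => g ((jumpIndex p (n * c) + 1 : ℕ) / n)) atTop (𝓝 u) := by
  by_cases hp : p
  · rw [← h.eq_right hp]
    exact (h.continuousWithinAt_Ici hp).tendsto.comp (tendsto_jumpIndex_succ_div_nhdsGE hc)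
  · refine h.tendsto_right.comp
      (tendsto_nhdsWithin_iff.2 ⟨DiscreteSchrodinger.tendsto_jumpIndex_succ_div hc, ?_⟩)
    filter_upwards [eventually_gt_atTop 0] with n hn
    rw [jumpIndex_succ_div_eq hc hn]
    exact lt_add_of_pos_right _
      (div_pos (sub_pos.2 (jumpFract_lt_one hp _)) (Nat.cast_pos.2 hn))

theorem continuousWithinAt_Icc_of_jumpIndex_ne [Decidable p] (h : HasJump p g c l u) {n k : ℕ}
    (hn : 0 < n) (hk : jumpIndex p (n * c) ≠ k) (hc : c ∈ Set.Icc (k / n : ℝ) ((k + 1 : ℕ) / n)) :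
    ContinuousWithinAt g (Set.Icc (k / n : ℝ) ((k + 1 : ℕ) / n)) c := by
  have hn' : (n : ℝ) ≠ 0 := Nat.cast_ne_zero.2 hn.ne'
  rcases Set.eq_endpoints_or_mem_Ioo_of_mem_Icc hc with heq | heq | hmem
  · have hp : p := by
      by_contra hp
      exact hk (by rw [heq, mul_div_cancel₀ _ hn', jumpIndex_natCast hp])
    exact (h.continuousWithinAt_Ici hp).mono (heq ▸ Set.Icc_subset_Ici_self)
  · have hp : ¬p := fun hp =>
      hk (by rw [heq, mul_div_cancel₀ _ hn', Nat.cast_add_one, jumpIndex_natCast_add_one hp])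
    exact (h.continuousWithinAt_Iic hp).mono (heq ▸ Set.Icc_subset_Iic_self)
  · exact absurd hmem (notMem_Ioo_of_jumpIndex_ne hn hk)

theorem tendsto_nhdsLE_inf_ae (h : HasJump p g c l u) :
    Tendsto g (𝓝[≤] c ⊓ ae volume) (𝓝 l) := by
  refine h.tendsto_left.mono_left (le_inf (inf_le_left.trans nhdsWithin_le_nhds) ?_)
  have hle : ∀ᶠ x in 𝓝[≤] c ⊓ ae volume, x ≤ c :=
    mem_inf_of_left self_mem_nhdsWithin
  have hne : ∀ᶠ x in 𝓝[≤] c ⊓ ae volume, x ≠ c :=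
    mem_inf_of_right (Measure.ae_ne volume c)
  refine le_principal_iff.2 ?_
  filter_upwards [hle, hne] with x hx hx' using lt_of_le_of_ne hx hx'

theorem tendsto_mul_integral_left [Decidable p] (h : HasJump p g c l u) (hc : 0 < c)
    (hg : StronglyMeasurableAtFilter g (𝓝 c)) :
    Tendsto (fun n : ℕ => n * (∫ x in (jumpIndex p (n * c) / n : ℝ)..c, g x) -
      jumpFract p (n * c) * l) atTop (𝓝 0) := by
  have hlength {n : ℕ} (hn : 0 < n) :
      (n : ℝ) * (c - jumpIndex p (n * c) / n) = jumpFract p (n * c) := by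
    rw [jumpIndex_div_eq hc hn, sub_sub_cancel, mul_div_cancel₀ _ (Nat.cast_ne_zero.2 hn.ne')]
  refine (tendsto_mul_integral_sub_of_tendsto_ae (B := 1)
    (hg.filter_mono nhdsWithin_le_nhds) h.tendsto_nhdsLE_inf_ae
    (tendsto_jumpIndex_div_nhdsLE (p := p) hc) (tendsto_const_nhdsWithin Set.self_mem_Iic)
    ?_).congr' ?_
  · filter_upwards [eventually_gt_atTop 0] with n hn
    rw [hlength hn, abs_of_nonneg (jumpFract_nonneg _)]
    exact jumpFract_le_one _
  · filter_upwards [eventually_gt_atTop 0] with n hn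
    rw [hlength hn]

theorem tendsto_mul_integral_right [Decidable p] (h : HasJump p g c l u) (hc : 0 < c)
    (hg : StronglyMeasurableAtFilter g (𝓝 c)) :
    Tendsto (fun n : ℕ => n * (∫ x in c..((jumpIndex p (n * c) + 1 : ℕ) / n : ℝ), g x) -
      (1 - jumpFract p (n * c)) * u) atTop (𝓝 0) := by
  have hlength {n : ℕ} (hn : 0 < n) :
      (n : ℝ) * ((jumpIndex p (n * c) + 1 : ℕ) / n - c) = 1 - jumpFract p (n * c) := by
    rw [jumpIndex_succ_div_eq hc hn, add_sub_cancel_left,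
      mul_div_cancel₀ _ (Nat.cast_ne_zero.2 hn.ne')]
  refine (tendsto_mul_integral_sub_of_tendsto_ae (B := 1)
    (hg.filter_mono nhdsWithin_le_nhds) (h.tendsto_right.mono_left inf_le_left)
    (tendsto_const_nhdsWithin Set.self_mem_Ici) (tendsto_jumpIndex_succ_div_nhdsGE (p := p) hc)
    ?_).congr' ?_
  · filter_upwards [eventually_gt_atTop 0] with n hn
    rw [hlength hn, abs_of_nonneg (sub_nonneg.2 (jumpFract_le_one _))]
    exact sub_le_self _ (jumpFract_nonneg _)
  · filter_upwards [eventually_gt_atTop 0] with n hn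
    rw [hlength hn]

theorem tendsto_mul_integral [Decidable p] (h : HasJump p g c l u) (hc : 0 < c)
    (hg : IntegrableAtFilter g (𝓝 c)) :
    Tendsto (fun n : ℕ =>
      n * (∫ x in (jumpIndex p (n * c) / n : ℝ)..((jumpIndex p (n * c) + 1 : ℕ) / n), g x) -
        (jumpFract p (n * c) * l + (1 - jumpFract p (n * c)) * u)) atTop (𝓝 0) := by
  have hmeas : StronglyMeasurableAtFilter g (𝓝 c) := by
    obtain ⟨s, hs, hgs⟩ := hg
    exact ⟨s, hs, hgs.aestronglyMeasurable⟩
  have hsum := (h.tendsto_mul_integral_left hc hmeas).add (h.tendsto_mul_integral_right hc hmeas)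
  rw [add_zero] at hsum
  refine hsum.congr' ?_
  filter_upwards [
    eventually_intervalIntegrable_of_integrableAtFilter hg
      (DiscreteSchrodinger.tendsto_jumpIndex_div (p := p) hc) tendsto_const_nhds,
    eventually_intervalIntegrable_of_integrableAtFilter hg
      tendsto_const_nhds (DiscreteSchrodinger.tendsto_jumpIndex_succ_div (p := p) hc)]
    with n hint hint'
  rw [← intervalIntegral.integral_add_adjacent_intervals hint hint']
  ring

end HasJump

section Sample

/-- The value of `g` at the grid point `k / n` of `[0, 1]`; the cap at `1` keeps the argument in
`[0, 1]` for all `k`. -/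
def sample (g : ℝ → ℝ) (n k : ℕ) : ℝ := g (min (k / n) 1)

variable {g : ℝ → ℝ} {n k : ℕ}

theorem sample_of_le (hk : k ≤ n) : sample g n k = g (k / n) := by
  rw [sample, min_eq_left (div_le_one_of_le₀ (Nat.cast_le.2 hk) n.cast_nonneg)]

theorem sample_zero_right (g : ℝ → ℝ) (n : ℕ) : sample g n 0 = g 0 := by
  rw [sample_of_le n.zero_le, Nat.cast_zero, zero_div]

theorem sample_self (hn : 0 < n) : sample g n n = g 1 := by
  rw [sample_of_le le_rfl, div_self (Nat.cast_ne_zero.2 hn.ne')]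

theorem sample_mem {K : Set ℝ} (hg : Set.MapsTo g (Set.Icc 0 1) K) (n k : ℕ) :
    sample g n k ∈ K :=
  hg ⟨le_min (by positivity) zero_le_one, min_le_right _ _⟩

theorem Icc_div_subset_Icc_zero_one (hk : k < n) :
    Set.Icc (k / n : ℝ) ((k + 1 : ℕ) / n) ⊆ Set.Icc 0 1 :=
  Set.Icc_subset_Icc (by positivity) (div_le_one_of_le₀ (Nat.cast_le.2 hk) n.cast_nonneg)

theorem Ioo_div_subset_of_jumpIndex_ne {ι : Type*} {c : ι → ℝ} {R : ι → Prop} [DecidablePred R]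
    (hk : k < n) (hK : ∀ j, jumpIndex (R j) (n * c j) ≠ k) :
    Set.Ioo (k / n : ℝ) ((k + 1 : ℕ) / n) ⊆ Set.Icc 0 1 \ Set.range c := by
  refine fun x hx => ⟨Icc_div_subset_Icc_zero_one hk (Set.Ioo_subset_Icc_self hx), ?_⟩
  rintro ⟨j, rfl⟩
  exact notMem_Ioo_of_jumpIndex_ne (pos_of_gt hk) (hK j) hx

theorem eventually_add_lt_of_tendsto_div {u v : ℕ → ℕ} {x y : ℝ}
    (hu : Tendsto (fun n => (u n / n : ℝ)) atTop (𝓝 x))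
    (hv : Tendsto (fun n => (v n / n : ℝ)) atTop (𝓝 y)) (hxy : x < y) (N : ℕ) :
    ∀ᶠ n in atTop, u n + N < v n := by
  have huN := hu.add (tendsto_const_div_atTop_nhds_zero_nat (N : ℝ))
  rw [add_zero] at huN
  filter_upwards [huN.eventually_lt hv hxy, eventually_gt_atTop 0] with n hlt hn
  rw [← add_div, div_lt_div_iff_of_pos_right (Nat.cast_pos.2 hn)] at hlt
  exact_mod_cast hlt

end Sample

/-- `g` is twice differentiable with bounded second derivative on `[0, 1]` away from the distinct
interior points `c j`, and has a jump from `l j` to `u j` at `c j`, where it is right-continuous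
if `R j` holds and left-continuous otherwise. -/
structure PiecewiseSmooth {ι : Type*} (c : ι → ℝ) (R : ι → Prop) (g : ℝ → ℝ) (l u : ι → ℝ) :
    Prop where
  injective : Function.Injective c
  mem_Ioo : ∀ j, c j ∈ Set.Ioo 0 1
  twiceDiffBddOn : TwiceDiffBddOn g (Set.Icc 0 1 \ Set.range c)
  hasJump : ∀ j, HasJump (R j) g (c j) (l j) (u j)

namespace PiecewiseSmooth

variable {ι : Type*} {c : ι → ℝ} {R : ι → Prop} {g : ℝ → ℝ} {l u : ι → ℝ}

theorem eventually_mem (h : PiecewiseSmooth c R g l u) {K : Set ℝ}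
    (hg : Set.MapsTo g (Set.Icc 0 1) K) (j : ι) : ∀ᶠ x in 𝓝 (c j), g x ∈ K :=
  mem_of_superset (Icc_mem_nhds (h.mem_Ioo j).1 (h.mem_Ioo j).2) hg

theorem left_mem (h : PiecewiseSmooth c R g l u) {K : Set ℝ} (hK : IsClosed K)
    (hg : Set.MapsTo g (Set.Icc 0 1) K) (j : ι) : l j ∈ K :=
  (h.hasJump j).left_mem hK (h.eventually_mem hg j)

theorem right_mem (h : PiecewiseSmooth c R g l u) {K : Set ℝ} (hK : IsClosed K)
    (hg : Set.MapsTo g (Set.Icc 0 1) K) (j : ι) : u j ∈ K :=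
  (h.hasJump j).right_mem hK (h.eventually_mem hg j)

theorem comp [Finite ι] (h : PiecewiseSmooth c R g l u) {φ : ℝ → ℝ} {K U : Set ℝ}
    (hφ : ContDiffOn ℝ 2 φ U) (hU : IsOpen U) (hK : IsClosed K) (hKU : K ⊆ U)
    (hg : Set.MapsTo g (Set.Icc 0 1) K) :
    PiecewiseSmooth c R (φ ∘ g) (φ ∘ l) (φ ∘ u) where
  injective := h.injective
  mem_Ioo := h.mem_Ioo
  twiceDiffBddOn := h.twiceDiffBddOn.comp (Set.finite_range c) (convex_Icc 0 1)
    (Metric.isBounded_Icc 0 1) hU hφ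
    ((closure_minimal (hg.mono_left Set.sdiff_subset).image_subset hK).trans hKU)
  hasJump j := (h.hasJump j).comp
    (hφ.continuousOn.continuousAt (hU.mem_nhds (hKU (h.left_mem hK hg j))))
    (hφ.continuousOn.continuousAt (hU.mem_nhds (hKU (h.right_mem hK hg j))))

theorem continuousOn_diff (h : PiecewiseSmooth c R g l u) :
    ContinuousOn g (Set.Icc 0 1 \ Set.range c) := by
  obtain ⟨g₁, g₂, M, hg⟩ := h.twiceDiffBddOn
  exact fun x hx => (hg x hx).1.continuousWithinAt

theorem isBounded_image [Finite ι] (h : PiecewiseSmooth c R g l u) :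
    Bornology.IsBounded (g '' (Set.Icc 0 1 \ Set.range c)) := by
  obtain ⟨g₁, g₂, M, hg⟩ := h.twiceDiffBddOn
  obtain ⟨B, hB⟩ := (isBounded_image_diff_of_hasDerivWithinAt (Set.finite_range c)
    (convex_Icc 0 1) (Metric.isBounded_Icc 0 1) (fun x hx => (hg x hx).2.1)
    fun x hx => (hg x hx).2.2).exists_norm_le
  exact isBounded_image_diff_of_hasDerivWithinAt (Set.finite_range c) (convex_Icc 0 1)
    (Metric.isBounded_Icc 0 1) (fun x hx => (hg x hx).1)
    fun x hx => hB _ (Set.mem_image_of_mem g₁ hx)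

theorem integrableOn [Finite ι] (h : PiecewiseSmooth c R g l u) :
    IntegrableOn g (Set.Icc 0 1) := by
  obtain ⟨B, hB⟩ := h.isBounded_image.exists_norm_le
  have hrange : volume (Set.range c) = 0 := (Set.finite_range c).measure_zero volume
  have hmeas : MeasurableSet (Set.Icc 0 1 \ Set.range c) :=
    measurableSet_Icc.diff (Set.finite_range c).measurableSet
  refine IntegrableOn.congr_set_ae ?_ (sdiff_null_ae_eq_self hrange).symm
  refine IntegrableOn.of_bound (measure_lt_top_of_subset Set.sdiff_subset (by simp))
    (h.continuousOn_diff.aestronglyMeasurable hmeas) B ?_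
  exact (ae_restrict_iff' hmeas).2
    (Eventually.of_forall fun x hx => hB _ (Set.mem_image_of_mem g hx))

theorem integrableAtFilter [Finite ι] (h : PiecewiseSmooth c R g l u) (j : ι) :
    IntegrableAtFilter g (𝓝 (c j)) :=
  ⟨_, Icc_mem_nhds (h.mem_Ioo j).1 (h.mem_Ioo j).2, h.integrableOn⟩

theorem intervalIntegrable_cell [Finite ι] (h : PiecewiseSmooth c R g l u) {n k : ℕ}
    (hk : k < n) : IntervalIntegrable g volume (k / n) ((k + 1 : ℕ) / n) := by
  have hle : (k / n : ℝ) ≤ (k + 1 : ℕ) / n := by gcongr; exact k.le_succ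
  rw [intervalIntegrable_iff_integrableOn_Icc_of_le hle]
  exact h.integrableOn.mono_set (Icc_div_subset_Icc_zero_one hk)

theorem prod_exp_mul_integral_cell [Finite ι] (h : PiecewiseSmooth c R g l u) {n : ℕ}
    (hn : 0 < n) :
    ∏ k ∈ Finset.range n, Real.exp (n * ∫ x in (k / n : ℝ)..((k + 1 : ℕ) / n), g x) =
      Real.exp (∫ x in (0 : ℝ)..1, g x) ^ n := by
  have hsum := intervalIntegral.sum_integral_adjacent_intervals (μ := volume) (f := g)
    (a := fun k : ℕ => (k / n : ℝ)) (n := n) fun k hk => h.intervalIntegrable_cell hk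
  rw [← Real.exp_sum, ← Finset.mul_sum, hsum, Nat.cast_zero, zero_div,
    div_self (Nat.cast_ne_zero.2 hn.ne'), Real.exp_nat_mul]

section RegularCell

variable [DecidablePred R]

theorem continuousOn_Icc_of_jumpIndex_ne [Finite ι] (h : PiecewiseSmooth c R g l u) {n k : ℕ}
    (hk : k < n) (hK : ∀ j, jumpIndex (R j) (n * c j) ≠ k) :
    ContinuousOn g (Set.Icc (k / n : ℝ) ((k + 1 : ℕ) / n)) := by
  intro x hx
  by_cases hxc : x ∈ Set.range c
  · obtain ⟨j, rfl⟩ := hxc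
    exact (h.hasJump j).continuousWithinAt_Icc_of_jumpIndex_ne (pos_of_gt hk) (hK j) hx
  · have hx₀₁ := Icc_div_subset_Icc_zero_one hk hx
    have hcompl : (Set.range c)ᶜ ∈ 𝓝 x :=
      (Set.finite_range c).isClosed.isOpen_compl.mem_nhds hxc
    refine ((continuousWithinAt_inter hcompl).1 ?_).mono (Icc_div_subset_Icc_zero_one hk)
    rw [← Set.sdiff_eq]
    exact h.continuousOn_diff x ⟨hx₀₁, hxc⟩

theorem exists_sample_bounds [Finite ι] (h : PiecewiseSmooth c R g l u) :
    ∃ L M : ℝ, 0 ≤ L ∧ 0 ≤ M ∧ ∀ n k : ℕ, k < n → (∀ j, jumpIndex (R j) (n * c j) ≠ k) →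
      |sample g n (k + 1) - sample g n k| ≤ L / n ∧
      |n * (∫ x in (k / n : ℝ)..((k + 1 : ℕ) / n), g x) -
        (sample g n k + sample g n (k + 1)) / 2| ≤ M / n ^ 2 := by
  obtain ⟨L, M, hL, hM, hcell⟩ := h.twiceDiffBddOn.exists_cell_bounds (Set.finite_range c)
    (convex_Icc 0 1) (Metric.isBounded_Icc 0 1)
  refine ⟨L, M, hL, hM, fun n k hk hK => ?_⟩
  have hn : (0 : ℝ) < n := Nat.cast_pos.2 (pos_of_gt hk)
  have hlt : (k / n : ℝ) < (k + 1 : ℕ) / n := by gcongr; exact k.lt_succ_self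
  have hlength : ((k + 1 : ℕ) / n - k / n : ℝ) = 1 / n := by
    rw [← sub_div, Nat.cast_add_one, add_sub_cancel_left]
  obtain ⟨hstep, htrapezoid⟩ := hcell _ _ hlt (Ioo_div_subset_of_jumpIndex_ne hk hK)
    (h.continuousOn_Icc_of_jumpIndex_ne hk hK)
  rw [hlength] at hstep htrapezoid
  rw [sample_of_le hk.le, sample_of_le (Nat.succ_le_of_lt hk)]
  refine ⟨by rwa [mul_one_div] at hstep, ?_⟩
  calc _ = n * |(∫ x in (k / n : ℝ)..((k + 1 : ℕ) / n), g x) -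
          1 / n * (g (k / n) + g ((k + 1 : ℕ) / n)) / 2| := by
        rw [← abs_of_pos hn, ← abs_mul, abs_of_pos hn]
        congr 1
        field_simp
    _ ≤ n * (M * (1 / n) ^ 3) := by gcongr
    _ = M / n ^ 2 := by field_simp

theorem eventually_isolated [Finite ι] (h : PiecewiseSmooth c R g l u) (N : ℕ) (j : ι) :
    ∀ᶠ n : ℕ in atTop, N ≤ jumpIndex (R j) (n * c j) ∧ jumpIndex (R j) (n * c j) + N < n ∧
      ∀ j', j' ≠ j → jumpIndex (R j) (n * c j) < jumpIndex (R j') (n * c j') ∨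
        jumpIndex (R j') (n * c j') + N < jumpIndex (R j) (n * c j) := by
  have hindex (j : ι) := tendsto_jumpIndex_div (p := R j) (h.mem_Ioo j).1
  have hzero : Tendsto (fun n : ℕ => ((0 : ℕ) / n : ℝ)) atTop (𝓝 0) := by
    simpa only [Nat.cast_zero, zero_div] using tendsto_const_nhds
  have hone : Tendsto (fun n : ℕ => (n / n : ℝ)) atTop (𝓝 1) :=
    tendsto_const_nhds.congr' <| (eventually_ne_atTop 0).mono fun n hn =>
      (div_self (Nat.cast_ne_zero.2 hn)).symm
  refine (eventually_add_lt_of_tendsto_div hzero (hindex j) (h.mem_Ioo j).1 N).and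
    (eventually_add_lt_of_tendsto_div (hindex j) hone (h.mem_Ioo j).2 N |>.and
      (eventually_all.2 fun j' => ?_)) |>.mono fun n hn => ⟨by omega, hn.2⟩
  by_cases hj : j' = j
  · exact Eventually.of_forall fun n hne => absurd hj hne
  rcases (h.injective.ne hj).lt_or_gt with hlt | hlt
  · exact (eventually_add_lt_of_tendsto_div (hindex j') (hindex j) hlt N).mono
      fun n hn _ => Or.inr hn
  · exact (eventually_add_lt_of_tendsto_div (hindex j) (hindex j') hlt 0).mono
      fun n hn _ => Or.inl hn

theorem exists_stepArray [Finite ι] (h : PiecewiseSmooth c R g l u) {σ : ℝ} (hσ : 0 < σ)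
    (hg : Set.MapsTo g (Set.Icc 0 1) (Set.Ici σ)) :
    ∃ L, StepArray (sample g) (fun j n => jumpIndex (R j) (n * c j)) σ L := by
  obtain ⟨L, _, hL, _, hcell⟩ := h.exists_sample_bounds
  exact ⟨L, hσ, hL, sample_mem hg, fun n k hk hK => (hcell n k hk hK).1,
    h.eventually_isolated⟩

end RegularCell

end PiecewiseSmooth

/-- The factor of a cell in the factorization of the determinant, normalized by the exponential of
the mean of `g` over the cell. -/
def cellFactor (g : ℝ → ℝ) (n k : ℕ) : ℝ :=
  Real.exp (sample g n (k + 1)) * transmission (sample g n k) (sample g n (k + 1)) /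
    Real.exp (n * ∫ x in (k / n : ℝ)..((k + 1 : ℕ) / n), g x)

/-- The contribution `β γ ^ θ` of a jump from `l` to `u` whose position in its grid cell is `θ`. -/
def jumpFactor (l u θ : ℝ) : ℝ := transmission l u * Real.exp (θ * (u - l))

theorem isBigO_jumpFactor (l u : ℝ) {α : Type*} {F : Filter α} {θ : α → ℝ}
    (hθ : ∀ i, θ i ∈ Set.Icc (0 : ℝ) 1) :
    (fun i => jumpFactor l u (θ i)) =O[F] fun _ => (1 : ℝ) := by
  refine Asymptotics.IsBigO.of_bound (|transmission l u| * Real.exp |u - l|)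
    (Eventually.of_forall fun i => ?_)
  rw [norm_one, mul_one, jumpFactor, Real.norm_eq_abs, abs_mul, Real.abs_exp]
  gcongr
  calc θ i * (u - l) ≤ θ i * |u - l| := by gcongr; exacts [(hθ i).1, le_abs_self _]
    _ ≤ |u - l| := mul_le_of_le_one_left (abs_nonneg _) (hθ i).2

theorem log_cellFactor {g : ℝ → ℝ} {n k : ℕ} (h : 0 < sample g n k)
    (h' : 0 < sample g n (k + 1)) :
    Real.log (cellFactor g n k) =
      sample g n (k + 1) + Real.log (transmission (sample g n k) (sample g n (k + 1))) -
        n * ∫ x in (k / n : ℝ)..((k + 1 : ℕ) / n), g x := by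
  have hpos := transmission_pos h h'
  rw [cellFactor, Real.log_div (by positivity) (by positivity), Real.log_mul (by positivity)
    hpos.ne', Real.log_exp, Real.log_exp]

theorem StepArray.eventually_prod_range_eq {ι : Type*} [Fintype ι] {a : ℕ → ℕ → ℝ}
    {K : ι → ℕ → ℕ} {σ L : ℝ} (h : StepArray a K σ L) (F : ℕ → ℕ → ℝ) :
    ∀ᶠ n in atTop, ∏ k ∈ Finset.range n, F n k =
      (∏ k ∈ Finset.range n \ Finset.univ.image (K · n), F n k) * ∏ j, F n (K j n) := by
  filter_upwards [eventually_all.2 (h.isolated 0)] with n hn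
  have hinj : Function.Injective (K · n) := by
    intro j j' hjj'
    by_contra hne
    have := (hn j').2.2 j hne
    dsimp only at hjj'
    omega
  have hsub : Finset.univ.image (K · n) ⊆ Finset.range n := by
    refine Finset.image_subset_iff.2 fun j _ => Finset.mem_range.2 ?_
    exact (hn j).2.1
  rw [← Finset.prod_sdiff hsub, Finset.prod_image hinj.injOn]

namespace PiecewiseSmooth

variable {ι : Type*} {c : ι → ℝ} {R : ι → Prop} [DecidablePred R] {g : ℝ → ℝ} {l u : ι → ℝ}
  {σ : ℝ}

theorem tendsto_prod_cellFactor_regular [Fintype ι] (h : PiecewiseSmooth c R g l u) (hσ : 0 < σ)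
    (hg : Set.MapsTo g (Set.Icc 0 1) (Set.Ici σ)) :
    Tendsto (fun n : ℕ => ∏ k ∈ Finset.range n \
      Finset.univ.image (fun j => jumpIndex (R j) (n * c j)), cellFactor g n k) atTop (𝓝 1) := by
  obtain ⟨L, M, _, hM, hcell⟩ := h.exists_sample_bounds
  have hsample := sample_mem hg
  have hpos (n k : ℕ) : 0 < sample g n k := hσ.trans_le (hsample n k)
  refine tendsto_prod_of_abs_log_le (C := M + L ^ 2 / (1 - Real.exp (-σ)) ^ 2)
    (fun n => Finset.sdiff_subset)
    (fun n k _ => div_pos (mul_pos (Real.exp_pos _) (transmission_pos (hpos n k) (hpos n _)))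
      (Real.exp_pos _)) (by positivity) fun n k hk => ?_
  simp only [Finset.mem_sdiff, Finset.mem_range, Finset.mem_image, Finset.mem_univ, true_and,
    not_exists] at hk
  obtain ⟨hstep, htrapezoid⟩ := hcell n k hk.1 hk.2
  rw [abs_sub_comm] at hstep
  have htransmission := abs_log_transmission_sub_le hσ (hsample n k) (hsample n (k + 1))
  have hsq : (sample g n k - sample g n (k + 1)) ^ 2 ≤ (L / n) ^ 2 :=
    sq_le_sq.2 (hstep.trans (le_abs_self _))
  rw [log_cellFactor (hpos n k) (hpos n (k + 1))]
  set s := sample g n k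
  set t := sample g n (k + 1)
  set J := n * ∫ x in (k / n : ℝ)..((k + 1 : ℕ) / n), g x
  calc |t + Real.log (transmission s t) - J|
      = |(Real.log (transmission s t) - (s - t) / 2) - (J - (s + t) / 2)| := by congr 1; ring
    _ ≤ |Real.log (transmission s t) - (s - t) / 2| + |J - (s + t) / 2| := abs_sub _ _
    _ ≤ (L / n) ^ 2 / (1 - Real.exp (-σ)) ^ 2 + M / n ^ 2 := by
        gcongr
        exact htransmission.trans (by gcongr)
    _ = (M + L ^ 2 / (1 - Real.exp (-σ)) ^ 2) / n ^ 2 := by ring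

theorem isEquivalent_cellFactor_jump [Finite ι] (h : PiecewiseSmooth c R g l u) (hσ : 0 < σ)
    (hg : Set.MapsTo g (Set.Icc 0 1) (Set.Ici σ)) (j : ι) :
    Asymptotics.IsEquivalent atTop (fun n : ℕ => cellFactor g n (jumpIndex (R j) (n * c j)))
      fun n : ℕ => jumpFactor (l j) (u j) (jumpFract (R j) (n * c j)) := by
  have hc := (h.mem_Ioo j).1
  have hl : 0 < l j := hσ.trans_le (h.left_mem isClosed_Ici hg j)
  have hu : 0 < u j := hσ.trans_le (h.right_mem isClosed_Ici hg j)
  have hK_lt : ∀ᶠ n : ℕ in atTop, jumpIndex (R j) (n * c j) < n :=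
    (h.eventually_isolated 0 j).mono fun n hn => hn.2.1
  have hleft : Tendsto (fun n : ℕ => sample g n (jumpIndex (R j) (n * c j))) atTop (𝓝 (l j)) :=
    ((h.hasJump j).tendsto_jumpIndex_div hc).congr' <|
      hK_lt.mono fun n hn => (sample_of_le hn.le).symm
  have hright : Tendsto (fun n : ℕ => sample g n (jumpIndex (R j) (n * c j) + 1)) atTop
      (𝓝 (u j)) :=
    ((h.hasJump j).tendsto_jumpIndex_succ_div hc).congr' <|
      hK_lt.mono fun n hn => (sample_of_le hn).symm
  have hexp := Real.continuous_exp.continuousAt.tendsto.comp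
    ((hright.sub_const (u j)).sub
      ((h.hasJump j).tendsto_mul_integral hc (h.integrableAtFilter j)))
  have hlim := ((tendsto_transmission hl hu hleft hright).div_const
    (transmission (l j) (u j))).mul hexp
  rw [div_self (transmission_pos hl hu).ne', sub_self, sub_zero, Real.exp_zero, one_mul] at hlim
  refine Asymptotics.isEquivalent_of_tendsto_one (hlim.congr fun n => ?_)
  rw [Pi.div_apply, cellFactor, jumpFactor, Function.comp_apply, div_div,
    mul_comm (Real.exp (sample _ _ _)), mul_left_comm, ← Real.exp_add, mul_div_mul_comm,
    ← Real.exp_sub]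
  congr 2
  ring

theorem isEquivalent_prod_cellFactor [Fintype ι] (h : PiecewiseSmooth c R g l u) (hσ : 0 < σ)
    (hg : Set.MapsTo g (Set.Icc 0 1) (Set.Ici σ)) :
    Asymptotics.IsEquivalent atTop (fun n : ℕ => ∏ k ∈ Finset.range n, cellFactor g n k)
      fun n : ℕ => ∏ j, jumpFactor (l j) (u j) (jumpFract (R j) (n * c j)) := by
  obtain ⟨L, hstep⟩ := h.exists_stepArray hσ hg
  have hregular := (Asymptotics.isEquivalent_const_iff_tendsto one_ne_zero).2
    (h.tendsto_prod_cellFactor_regular hσ hg)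
  have hjump := Asymptotics.IsEquivalent.finsetProd fun j (_ : j ∈ Finset.univ) =>
    h.isEquivalent_cellFactor_jump hσ hg j
  refine ((hregular.mul hjump).congr_left ?_).congr_right (Eventually.of_forall fun n => ?_)
  · filter_upwards [hstep.eventually_prod_range_eq (cellFactor g)] with n hn
    simpa only [Pi.mul_apply, Finset.prod_apply] using hn.symm
  · simp only [Pi.mul_apply, Function.const_apply, one_mul]

theorem tendsto_det_tridiag_div [Fintype ι] (h : PiecewiseSmooth c R g l u) (hσ : 0 < σ)
    (hg : Set.MapsTo g (Set.Icc 0 1) (Set.Ici σ)) :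
    Tendsto (fun n : ℕ => (tridiag (fun i => 2 * Real.cosh (sample g n i)) n).det /
      Real.exp (∫ x in (0 : ℝ)..1, g x) ^ n -
        endpointFactor (g 0) (g 1) *
          ∏ j, jumpFactor (l j) (u j) (jumpFract (R j) (n * c j))) atTop (𝓝 0) := by
  obtain ⟨L, hstep⟩ := h.exists_stepArray hσ hg
  have hequiv := (hstep.isEquivalent_det_tridiag.div
    (Asymptotics.IsEquivalent.refl (u := fun n : ℕ =>
      Real.exp (∫ x in (0 : ℝ)..1, g x) ^ n))).congr_right
    (w := fun n : ℕ => endpointFactor (g 0) (g 1) * ∏ k ∈ Finset.range n, cellFactor g n k) <| by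
      filter_upwards [eventually_gt_atTop 0] with n hn
      simp only [Pi.div_apply, cellFactor, Finset.prod_div_distrib,
        h.prod_exp_mul_integral_cell hn, sample_zero_right, sample_self hn]
      rw [mul_div_assoc]
  have hlim := hequiv.trans
    (Asymptotics.IsEquivalent.refl.mul (h.isEquivalent_prod_cellFactor hσ hg))
  have hbdd : (fun n : ℕ => ∏ j, jumpFactor (l j) (u j) (jumpFract (R j) (n * c j)))
      =O[atTop] fun _ => (1 : ℝ) := by
    simpa only [Finset.prod_const_one] using
      Asymptotics.IsBigO.finsetProd fun j (_ : j ∈ Finset.univ) =>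
        isBigO_jumpFactor (l j) (u j) fun n : ℕ => ⟨jumpFract_nonneg _, jumpFract_le_one _⟩
  exact (Asymptotics.isLittleO_one_iff ℝ).1
    (hlim.isLittleO.trans_isBigO (hbdd.const_mul_left (endpointFactor (g 0) (g 1))))

end PiecewiseSmooth

section LogRoot

/-- The logarithm of the larger root of `z ^ 2 - y * z + 1`, that is, the `x ≥ 0` with
`2 * cosh x = y`. -/
def logRoot (y : ℝ) : ℝ := Real.arcosh (y / 2)

variable {x y : ℝ}

theorem sqrt_half_sq_sub_one (y : ℝ) : √((y / 2) ^ 2 - 1) = √(y ^ 2 - 4) / 2 := by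
  have hfour : √4 = (2 : ℝ) := by rw [Real.sqrt_eq_iff_mul_self_eq] <;> norm_num
  rw [← hfour, ← Real.sqrt_div' _ zero_le_four, hfour]
  congr 1
  ring

theorem logRoot_eq_log (y : ℝ) : logRoot y = Real.log ((y + √(y ^ 2 - 4)) / 2) := by
  rw [logRoot, Real.arcosh, sqrt_half_sq_sub_one, add_div]

theorem two_mul_cosh_logRoot (hy : 2 ≤ y) : 2 * Real.cosh (logRoot y) = y := by
  rw [logRoot, Real.cosh_arcosh (by linarith)]
  ring

theorem sinh_logRoot (hy : 2 ≤ y) : Real.sinh (logRoot y) = √(y ^ 2 - 4) / 2 := by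
  rw [logRoot, Real.sinh_arcosh (by linarith), sqrt_half_sq_sub_one]

theorem exp_logRoot (hy : 2 ≤ y) : Real.exp (logRoot y) = (y + √(y ^ 2 - 4)) / 2 := by
  rw [logRoot, Real.exp_arcosh (by linarith), sqrt_half_sq_sub_one, add_div]

theorem exp_neg_logRoot (hy : 2 ≤ y) : Real.exp (-logRoot y) = (y - √(y ^ 2 - 4)) / 2 := by
  rw [← Real.cosh_sub_sinh, sinh_logRoot hy]
  linear_combination two_mul_cosh_logRoot hy / 2

theorem logRoot_pos (hy : 2 < y) : 0 < logRoot y := Real.arcosh_pos (by linarith)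

theorem logRoot_le_logRoot (hx : 0 < x) (hxy : x ≤ y) : logRoot x ≤ logRoot y :=
  (Real.arcosh_le_arcosh (half_pos hx) (half_pos (hx.trans_le hxy))).2 (by linarith)

theorem contDiffOn_logRoot {n : WithTop ℕ∞} : ContDiffOn ℝ n logRoot (Set.Ioi 2) :=
  Real.contDiffOn_arcosh.comp (contDiff_id.div_const 2).contDiffOn fun y hy => by
    rw [Set.mem_Ioi] at hy ⊢
    exact (one_lt_div two_pos).2 hy

theorem rpow_one_fourth_eq (hx : 2 ≤ x) (hy : 2 ≤ y) :
    ((x ^ 2 - 4) * (y ^ 2 - 4)) ^ (1 / 4 : ℝ) =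
      2 * √(Real.sinh (logRoot x) * Real.sinh (logRoot y)) := by
  have hx' : 0 ≤ x ^ 2 - 4 := by nlinarith
  have hy' : 0 ≤ y ^ 2 - 4 := by nlinarith
  have hsqrt : √(x ^ 2 - 4) / 2 * (√(y ^ 2 - 4) / 2) = √((x ^ 2 - 4) * (y ^ 2 - 4)) / 2 ^ 2 := by
    rw [Real.sqrt_mul hx']
    ring
  rw [sinh_logRoot hx, sinh_logRoot hy, hsqrt, Real.sqrt_div (Real.sqrt_nonneg _),
    Real.sqrt_sq zero_le_two, mul_div_cancel₀ _ two_ne_zero, Real.sqrt_eq_rpow, Real.sqrt_eq_rpow,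
    ← Real.rpow_mul (mul_nonneg hx' hy')]
  norm_num

theorem alpha_eq_endpointFactor (hx : 2 ≤ x) (hy : 2 ≤ y) :
    alpha x y = endpointFactor (logRoot x) (logRoot y) := by
  rw [alpha, endpointFactor, rpow_one_fourth_eq hx hy, exp_logRoot hy]
  ring

theorem beta_eq_transmission (hx : 2 ≤ x) (hy : 2 ≤ y) :
    beta x y = transmission (logRoot x) (logRoot y) := by
  rw [beta, transmission, mul_comm (y ^ 2 - 4), rpow_one_fourth_eq hx hy, exp_logRoot hx,
    exp_neg_logRoot hy]
  ring

theorem gamma_rpow (hx : 2 ≤ x) (hy : 2 ≤ y) (θ : ℝ) :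
    gamma x y ^ θ = Real.exp (θ * (logRoot y - logRoot x)) := by
  rw [mul_comm, Real.exp_mul, Real.exp_sub, exp_logRoot hx, exp_logRoot hy,
    div_div_div_cancel_right₀ two_ne_zero, gamma]

theorem G_eq_exp_integral_logRoot (f : ℝ → ℝ) :
    G f = Real.exp (∫ x in (0 : ℝ)..1, (logRoot ∘ f) x) := by
  simp only [G, Function.comp_apply, logRoot_eq_log]

theorem D_eq_det_tridiag_sample {f : ℝ → ℝ} (hf : Set.MapsTo f (Set.Icc 0 1) (Set.Ici 2)) (n : ℕ) :
    D n f = (tridiag (fun k => 2 * Real.cosh (sample (logRoot ∘ f) n k)) n).det := by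
  have hcosh (k : ℕ) : 2 * Real.cosh (sample (logRoot ∘ f) n k) = sample f n k :=
    two_mul_cosh_logRoot (sample_mem hf n k)
  rw [D]
  congr 1
  ext i j
  simp only [T, tridiag, Matrix.of_apply, hcosh, sample_of_le (Nat.succ_le_of_lt i.isLt),
    Nat.cast_add_one]

end LogRoot

theorem PiecewiseSmooth.tendsto_D_div_G_pow {ι : Type*} [Fintype ι] {c : ι → ℝ} {R : ι → Prop}
    [DecidablePred R] {f : ℝ → ℝ} {l u : ι → ℝ} (h : PiecewiseSmooth c R f l u) {m : ℝ}
    (hm : 2 < m) (hf : Set.MapsTo f (Set.Icc 0 1) (Set.Ici m)) :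
    Tendsto (fun n : ℕ => D n f / G f ^ n - alpha (f 0) (f 1) *
      ∏ j, beta (l j) (u j) * gamma (l j) (u j) ^ jumpFract (R j) (n * c j)) atTop (𝓝 0) := by
  have hf₂ : Set.MapsTo f (Set.Icc 0 1) (Set.Ici 2) := hf.mono_right (Set.Ici_subset_Ici.2 hm.le)
  have hl (j : ι) : 2 ≤ l j := h.left_mem isClosed_Ici hf₂ j
  have hu (j : ι) : 2 ≤ u j := h.right_mem isClosed_Ici hf₂ j
  have hlogRoot : PiecewiseSmooth c R (logRoot ∘ f) (logRoot ∘ l) (logRoot ∘ u) :=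
    h.comp contDiffOn_logRoot isOpen_Ioi isClosed_Ici (Set.Ici_subset_Ioi.2 hm) hf
  refine (hlogRoot.tendsto_det_tridiag_div (logRoot_pos hm)
    fun x hx => logRoot_le_logRoot (two_pos.trans hm) (hf hx)).congr fun n => ?_
  rw [← G_eq_exp_integral_logRoot, ← D_eq_det_tridiag_sample hf₂, Function.comp_apply,
    Function.comp_apply, ← alpha_eq_endpointFactor (hf₂ (Set.left_mem_Icc.2 zero_le_one))
      (hf₂ (Set.right_mem_Icc.2 zero_le_one))]
  simp only [jumpFactor, Function.comp_apply, ← beta_eq_transmission (hl _) (hu _),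
    ← gamma_rpow (hl _) (hu _)]

end DiscreteSchrodinger

end

theorem mainTheorem8 (r : ℕ) (c : Fin r → ℝ) (hc_inj : Function.Injective c)
    (hc : ∀ j, c j ∈ Set.Ioo (0 : ℝ) 1)
    (f : ℝ → ℝ)
    (hf : DiscreteSchrodinger.TwiceDiffBddOn f (Set.Icc (0 : ℝ) 1 \ Set.range c))
    (fm fp : Fin r → ℝ)
    (hfm : ∀ j, Tendsto f (𝓝[<] (c j)) (𝓝 (fm j)))
    (hfp : ∀ j, Tendsto f (𝓝[>] (c j)) (𝓝 (fp j)))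
    (ε : ℝ) (hε : 0 < ε) (hf2 : ∀ x ∈ Set.Icc (0 : ℝ) 1, 2 + ε < f x) :
    -- (i) `f` is left-continuous at every `c j`
    ((∀ j, f (c j) = fm j) →
      Tendsto (fun n : ℕ =>
        DiscreteSchrodinger.D n f / DiscreteSchrodinger.G f ^ n -
          DiscreteSchrodinger.alpha (f 0) (f 1) *
            ∏ j, DiscreteSchrodinger.beta (fm j) (fp j) *
              DiscreteSchrodinger.gamma (fm j) (fp j) ^ Int.fract ((n : ℝ) * c j))
        atTop (𝓝 0)) ∧
    -- (ii) `f` is right-continuous at the `c j` with `j ∈ R`, left-continuous at the others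
    (∀ R : Finset (Fin r), (∀ j ∈ R, f (c j) = fp j) → (∀ j ∉ R, f (c j) = fm j) →
      Tendsto (fun n : ℕ =>
        DiscreteSchrodinger.D n f / DiscreteSchrodinger.G f ^ n -
          DiscreteSchrodinger.alpha (f 0) (f 1) *
            ∏ j, DiscreteSchrodinger.beta (fm j) (fp j) *
              DiscreteSchrodinger.gamma (fm j) (fp j) ^
                (if j ∈ R then DiscreteSchrodinger.fract' ((n : ℝ) * c j)
                  else Int.fract ((n : ℝ) * c j)))
        atTop (𝓝 0)) := by
  have hmixed (R : Finset (Fin r)) (hR : ∀ j ∈ R, f (c j) = fp j)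
      (hR' : ∀ j ∉ R, f (c j) = fm j) :=
    DiscreteSchrodinger.PiecewiseSmooth.tendsto_D_div_G_pow (R := (· ∈ R))
      ⟨hc_inj, hc, hf, fun j => ⟨hfm j, hfp j, hR' j, hR j⟩⟩ (lt_add_of_pos_right 2 hε)
      fun x hx => (hf2 x hx).le
  refine ⟨fun h => ?_, hmixed⟩
  simpa only [DiscreteSchrodinger.jumpFract, Finset.notMem_empty, if_false] using
    hmixed ∅ (fun j hj => absurd hj (Finset.notMem_empty j)) fun j _ => h j
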